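/- Theorem (Fundamental Identity of Gabor Analysis). Let $d\ge 0$ be an integer. For $(x,\omega)\in\mathbb{R}^d\times\mathbb{R}^d=\mathbb{R}^{2d}$ let $\pi(x,\omega)$ be the time-frequency shift on $L^2(\mathbb{R}^d)$, $\pi(x,\omega)f(t)=e^{2\pi i\,\omega\cdot t}f(t-x)$, and for $f,g\in L^2(\mathbb{R}^d)$ let $$V_gf(x,\omega)=\int_{\mathbb{R}^d}f(t)\,\overline{g(t-x)}\,e^{-2\pi i\,\omega\cdot t}\,dt$$ be the short-time Fourier transform. Let $M^1(\mathbb{R}^d)$ (Feichtinger's algebra) be the set of all $g\in L^2(\mathbb{R}^d)$ with $\iint_{\mathbb{R}^{2d}}|V_gg(x,\omega)|\,d(x,\omega)<\infty$. Let $\Lambda\subset\mathbb{R}^{2d}$ be a (full-rank) lattice, i.e. $\Lambda=M\mathbb{Z}^{2d}$ with $M\in GL(\mathbb{R},2d)$, let $\mathrm{vol}(\Lambda)=|\det M|$ be its volume, and let $\Lambda^\circ=\{\lambda^\circ\in\mathbb{R}^{2d} : \pi(\lambda)\pi(\lambda^\circ)=\pi(\lambda^\circ)\pi(\lambda)\text{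 for all }\lambda\in\Lambda\}$ be its adjoint lattice. Then for all $f,h\in L^2(\mathbb{R}^d)$ and all $g,\tilde g\in M^1(\mathbb{R}^d)$, $$\sum_{\lambda\in\Lambda}V_gf(\lambda)\,\overline{V_{\tilde g}h(\lambda)}=\mathrm{vol}(\Lambda)^{-1}\sum_{\lambda^\circ\in\Lambda^\circ}V_g\tilde g(\lambda^\circ)\,\overline{V_fh(\lambda^\circ)},$$ and both series converge absolutely. -/

import Mathlib

open MeasureTheory
open scoped ComplexConjugate

namespace Gabor

/-- The Euclidean space of dimension `d`. -/
abbrev Space (d : ℕ) : Type := EuclideanSpace ℝ (Fin d)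

/-- The time-frequency plane of dimension `2d`; its points are pairs `(x, ω)`. Its `volume` is the
product measure, that is, Lebesgue measure. -/
abbrev PhaseSpace (d : ℕ) : Type := Space d × Space d

/-- The time-frequency shift `π(x, ω) = M_ω T_x`, `(π(x, ω) f)(t) = e^{2πi ω·t} f(t - x)`. -/
noncomputable def tfShift {d : ℕ} (z : PhaseSpace d) (f : Space d → ℂ) : Space d → ℂ :=
  fun t => Complex.exp (2 * Real.pi * Complex.I * (inner ℝ z.2 t : ℝ)) * f (t - z.1)

/-- The short-time Fourier transform `V_g f` of `f` with respect to the window `g`,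
`V_g f (x, ω) = ∫ f(t) conj(g(t - x)) e^{-2πi ω·t} dt`. -/
noncomputable def stft {d : ℕ} (g f : Space d → ℂ) (z : PhaseSpace d) : ℂ :=
  ∫ t, f t * conj (g (t - z.1)) * Complex.exp (-(2 * Real.pi * Complex.I * (inner ℝ z.2 t : ℝ)))

/-- Feichtinger's algebra `M¹ = S₀`: the square-integrable `g` whose short-time Fourier transform
`V_g g` is integrable over the time-frequency plane. -/
def M1 (d : ℕ) : Set (Space d → ℂ) :=
  {g | MemLp g 2 volume ∧ Integrable (stft g g) volume}

/-- The adjoint lattice: the points `z` of the time-frequency plane for which `π(z)` commutes, as an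
operator on the square-integrable functions, with `π(l)` for all `l` in `Λ`. -/
def adjointLattice {d : ℕ} (Λ : Submodule ℤ (PhaseSpace d)) : Set (PhaseSpace d) :=
  {z | ∀ l ∈ Λ, ∀ f : Space d → ℂ, MemLp f 2 volume →
    tfShift l (tfShift z f) =ᵐ[volume] tfShift z (tfShift l f)}

end Gabor

/-! The left side is the value at 0 of the periodization over `Λ` of `F(z) = V_g f(z) · conj (V_{g'}
h(z))`, and the identity is Poisson summation for `F`. Two time-frequency shifts commute up to a
phase, and for fixed `w` this phase `commutator z w` is a character in `z`. Multiplying `F` by it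
amounts to replacing `g', h` by `π(w) g', π(w) h`, so Moyal's identity (`integral_coeff_mul`)
evaluates the Fourier integral of `F` as another product of two short-time Fourier transforms with
the functions regrouped (`integral_commutator_mul`). The characters that are trivial on `Λ` are
those with `w` in the adjoint lattice (`mem_adjointLattice_iff_exists`), and `w ↦ -w` brings the sum
into the stated form.

Since `f` and `h` are merely square-integrable, pointwise Poisson summation (`poisson_summation`)
needs two facts: the periodization converges everywhere to a continuous function, and its Fourier
coefficients are summable. Both rest on `tsum_coeff_ne_top`: for windows in `M¹`, `V_g g'` is
summable over separated families. This follows by dominating it by convolutions with the transform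
of a Gaussian (`enorm_coeff_le_convolution`).

The second fact is then immediate, the other factor being bounded. For the first, summability of the
Gram matrix gives a Bessel bound by Schur's test (`sum_sq_norm_inner_le`). The analysis operators
`T`, `T'` of the two windows are therefore bounded into `ℓ²`, and the periodization at `z` is `⟨T'
π(-z) h, T π(-z) f⟩`, continuous because the shifts are strongly continuous
(`exists_periodization`). -/

namespace Gabor

variable {d : ℕ}

/-! ### Time-frequency shifts as strongly continuous isometries of `L²`. -/

/-- The Hilbert space of square-integrable functions. -/
abbrev L2 (d : ℕ) : Type := Lp ℂ 2 (volume : Measure (Space d))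

/-- The character `t ↦ e^{2πi ω·t}`. -/
noncomputable def wave (ω t : Space d) : ℂ :=
  Complex.exp (2 * Real.pi * Complex.I * (inner ℝ ω t : ℝ))

lemma tfShift_apply (z : PhaseSpace d) (f : Space d → ℂ) (t : Space d) :
    tfShift z f t = wave z.2 t * f (t - z.1) := rfl

lemma norm_wave (ω t : Space d) : ‖wave ω t‖ = 1 := by
  rw [wave, show (2 * Real.pi * Complex.I * (inner ℝ ω t : ℝ) : ℂ)
    = ((2 * Real.pi * inner ℝ ω t : ℝ) : ℂ) * Complex.I by push_cast; ring]
  exact Complex.norm_exp_ofReal_mul_I _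

lemma conj_wave (ω t : Space d) : conj (wave ω t) = wave (-ω) t := by
  rw [wave, wave, ← Complex.exp_conj]
  simp [Complex.conj_ofNat]

lemma wave_add_right (ω s t : Space d) : wave ω (s + t) = wave ω s * wave ω t := by
  rw [wave, wave, wave, ← Complex.exp_add, inner_add_right]
  congr 1; push_cast; ring

lemma wave_add_left (ω η t : Space d) : wave (ω + η) t = wave ω t * wave η t := by
  rw [wave, wave, wave, ← Complex.exp_add, inner_add_left]
  congr 1; push_cast; ring

lemma wave_neg_right (ω t : Space d) : wave ω (-t) = wave (-ω) t := by
  simp [wave]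

@[simp] lemma wave_zero_left (t : Space d) : wave 0 t = 1 := by simp [wave]

@[simp] lemma wave_zero_right (t : Space d) : wave t 0 = 1 := by simp [wave]

lemma wave_mul_neg (ω t : Space d) : wave ω t * wave (-ω) t = 1 := by
  rw [← wave_add_left]; simp

lemma continuous_wave_right (ω : Space d) : Continuous (wave ω) := by
  unfold wave; fun_prop

lemma memLp_translate {f : Space d → ℂ} (hf : MemLp f 2) (x : Space d) :
    MemLp (fun t => f (t - x)) 2 :=
  hf.comp_measurePreserving (measurePreserving_sub_right volume x)

lemma memLp_wave_mul {f : Space d → ℂ} (hf : MemLp f 2) (ω : Space d) :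
    MemLp (fun t => wave ω t * f t) 2 :=
  hf.congr_norm ((continuous_wave_right ω).aestronglyMeasurable.mul hf.1)
    (by simp [norm_wave])

lemma memLp_tfShift {f : Space d → ℂ} (hf : MemLp f 2) (z : PhaseSpace d) :
    MemLp (tfShift z f) 2 :=
  memLp_wave_mul (memLp_translate hf z.1) z.2

lemma tfShift_congr {f g : Space d → ℂ} (h : f =ᵐ[volume] g) (z : PhaseSpace d) :
    tfShift z f =ᵐ[volume] tfShift z g := by
  have hq := (measurePreserving_sub_right (volume : Measure (Space d)) z.1).quasiMeasurePreserving
  have := hq.ae_eq_comp h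
  filter_upwards [this] with t ht
  simp only [Function.comp] at ht
  rw [tfShift_apply, tfShift_apply, ht]

/-- The time-frequency shift as an operator on the Hilbert space. -/
noncomputable def rep (z : PhaseSpace d) (f : L2 d) : L2 d :=
  (memLp_tfShift (Lp.memLp f) z).toLp _

lemma coeFn_rep (z : PhaseSpace d) (f : L2 d) : rep z f =ᵐ[volume] tfShift z f :=
  MemLp.coeFn_toLp _

lemma tfShift_tfShift (z w : PhaseSpace d) (f : Space d → ℂ) (t : Space d) :
    tfShift z (tfShift w f) t = wave (-w.2) z.1 * tfShift (z + w) f t := by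
  simp only [tfShift_apply, Prod.fst_add, Prod.snd_add, wave_add_left, sub_eq_add_neg t z.1,
    wave_add_right, wave_neg_right]
  rw [show t + -z.1 - w.1 = t - (z.1 + w.1) by abel]
  ring

lemma rep_rep (z w : PhaseSpace d) (f : L2 d) :
    rep z (rep w f) = wave (-w.2) z.1 • rep (z + w) f := by
  apply Lp.ext
  filter_upwards [coeFn_rep z (rep w f), Lp.coeFn_smul (wave (-w.2) z.1) (rep (z + w) f),
    coeFn_rep (z + w) f, tfShift_congr (coeFn_rep w f) z] with t h1 h2 h3 h4
  rw [h1, h2, h4, Pi.smul_apply, h3, tfShift_tfShift, smul_eq_mul]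

@[simp] lemma rep_zero (f : L2 d) : rep 0 f = f := by
  apply Lp.ext
  filter_upwards [coeFn_rep 0 f] with t h1
  simp [h1, tfShift_apply]

lemma inner_rep_rep (z : PhaseSpace d) (f g : L2 d) :
    inner ℂ (rep z f) (rep z g) = inner ℂ f g := by
  rw [L2.inner_def, L2.inner_def,
    ← integral_sub_right_eq_self (fun t => inner ℂ (f t) (g t)) z.1]
  refine integral_congr_ae ?_
  filter_upwards [coeFn_rep z f, coeFn_rep z g] with t h1 h2
  rw [h1, h2, tfShift_apply, tfShift_apply]
  simp only [RCLike.inner_apply, map_mul]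
  have := wave_mul_neg z.2 t
  rw [← conj_wave] at this
  linear_combination (g (t - z.1) * conj (f (t - z.1))) * this

lemma norm_rep (z : PhaseSpace d) (f : L2 d) : ‖rep z f‖ = ‖f‖ := by
  have := congrArg Complex.re (inner_rep_rep z f f)
  have h1 := inner_self_eq_norm_sq (𝕜 := ℂ) (rep z f)
  have h2 := inner_self_eq_norm_sq (𝕜 := ℂ) f
  simp only [RCLike.re_to_complex] at h1 h2
  rw [h1, h2] at this
  exact (sq_eq_sq₀ (norm_nonneg _) (norm_nonneg _)).1 this

lemma rep_sub (z : PhaseSpace d) (f g : L2 d) : rep z (f - g) = rep z f - rep z g := by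
  apply Lp.ext
  filter_upwards [coeFn_rep z (f - g), Lp.coeFn_sub (rep z f) (rep z g), coeFn_rep z f,
    coeFn_rep z g, tfShift_congr (Lp.coeFn_sub f g) z] with t h1 h2 h3 h4 h5
  rw [h1, h2, h5, Pi.sub_apply, h3, h4]
  simp only [tfShift_apply, Pi.sub_apply]
  ring

lemma continuous_translate (f : L2 d) : Continuous fun x : Space d => rep (x, 0) f := by
  have : Fact ((2 : ENNReal) ≠ ⊤) := ⟨ENNReal.ofNat_ne_top⟩
  have h : Continuous fun x : Space d => DomAddAct.mk (-x) +ᵥ f := by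
    have : Continuous fun x : Space d => DomAddAct.mk (-x) :=
      DomAddAct.continuous_mk.comp continuous_neg
    exact this.vadd continuous_const
  refine h.congr fun x => ?_
  apply Lp.ext
  filter_upwards [coeFn_rep (x, 0) f, DomAddAct.vadd_Lp_ae_eq (DomAddAct.mk (-x)) f] with t h1 h2
  rw [h1, h2, tfShift_apply]
  simp [sub_eq_neg_add]

lemma continuous_modulate (f : L2 d) : Continuous fun ω : Space d => rep (0, ω) f := by
  rw [continuous_iff_continuousAt]
  intro ω₀
  rw [ContinuousAt, tendsto_iff_norm_sub_tendsto_zero]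
  have key : Filter.Tendsto (fun ω => ∫ t, ‖wave ω t * f t - wave ω₀ t * f t‖ ^ 2) (nhds ω₀)
      (nhds (∫ _ : Space d, (0 : ℝ))) := by
    -- The two phases have modulus 1, so the difference is at most `2‖f t‖`; squaring gives the
    -- factor 4.
    refine tendsto_integral_filter_of_dominated_convergence (fun t => 4 * ‖f t‖ ^ 2) ?_ ?_ ?_ ?_
    · refine Filter.Eventually.of_forall fun ω => ?_
      exact ((((continuous_wave_right ω).aestronglyMeasurable.mul (Lp.memLp f).1).sub
        ((continuous_wave_right ω₀).aestronglyMeasurable.mul (Lp.memLp f).1)).norm.pow 2)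
    · refine Filter.Eventually.of_forall fun ω => Filter.Eventually.of_forall fun t => ?_
      have h1 : ‖wave ω t * f t - wave ω₀ t * f t‖ ≤ 2 * ‖f t‖ := by
        refine (norm_sub_le _ _).trans ?_
        simp only [norm_mul, norm_wave]
        linarith
      rw [Real.norm_of_nonneg (by positivity)]
      nlinarith [norm_nonneg (wave ω t * f t - wave ω₀ t * f t)]
    · exact ((memLp_two_iff_integrable_sq_norm (Lp.memLp f).1).1 (Lp.memLp f)).const_mul 4
    · refine Filter.Eventually.of_forall fun t => ?_
      have hc : Continuous fun ω => ‖wave ω t * f t - wave ω₀ t * f t‖ ^ 2 := by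
        unfold wave; fun_prop
      simpa using hc.tendsto ω₀
  rw [integral_zero] at key
  have h2 : ∀ ω, ‖rep (0, ω) f - rep (0, ω₀) f‖
      = Real.sqrt (∫ t, ‖wave ω t * f t - wave ω₀ t * f t‖ ^ 2) := by
    intro ω
    rw [← Real.sqrt_sq (norm_nonneg _)]
    congr 1
    have h3 := inner_self_eq_norm_sq (𝕜 := ℂ) (rep (0, ω) f - rep (0, ω₀) f)
    rw [← h3, L2.inner_def, ← integral_re (L2.integrable_inner _ _)]
    refine integral_congr_ae ?_
    filter_upwards [Lp.coeFn_sub (rep (0, ω) f) (rep (0, ω₀) f), coeFn_rep (0, ω) f,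
      coeFn_rep (0, ω₀) f] with t h4 h5 h6
    rw [inner_self_eq_norm_sq, h4, Pi.sub_apply, h5, h6]
    simp [tfShift_apply]
  simp only [h2]
  simpa [Function.comp_def] using (Real.continuous_sqrt.tendsto 0).comp key

/-- The time-frequency shifts are strongly continuous. -/
lemma continuous_rep (f : L2 d) : Continuous fun z : PhaseSpace d => rep z f := by
  rw [continuous_iff_continuousAt]
  intro z₀
  rw [ContinuousAt, tendsto_iff_norm_sub_tendsto_zero]
  have hsplit : ∀ z : PhaseSpace d, rep z f = rep (0, z.2) (rep (z.1, 0) f) := by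
    intro z; rw [rep_rep]; simp
  -- The modulation varies with `z`, but it is isometric, so the translation error passes through it
  -- unchanged.
  have hb : ∀ z : PhaseSpace d, ‖rep z f - rep z₀ f‖ ≤ ‖rep (z.1, 0) f - rep (z₀.1, 0) f‖ +
      ‖rep (0, z.2) (rep (z₀.1, 0) f) - rep (0, z₀.2) (rep (z₀.1, 0) f)‖ := by
    intro z
    rw [hsplit z, hsplit z₀]
    refine (norm_sub_le_norm_sub_add_norm_sub _ (rep (0, z.2) (rep (z₀.1, 0) f)) _).trans ?_
    rw [← rep_sub, norm_rep]
  have h1 : Continuous fun z : PhaseSpace d => ‖rep (z.1, 0) f - rep (z₀.1, 0) f‖ +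
      ‖rep (0, z.2) (rep (z₀.1, 0) f) - rep (0, z₀.2) (rep (z₀.1, 0) f)‖ :=
    ((((continuous_translate f).comp continuous_fst).sub continuous_const).norm).add
      ((((continuous_modulate (rep (z₀.1, 0) f)).comp continuous_snd).sub continuous_const).norm)
  refine squeeze_zero (fun _ => norm_nonneg _) hb ?_
  simpa using h1.tendsto z₀

/-! ### Short-time Fourier transforms as matrix coefficients. -/

/-- The short-time Fourier transform as a matrix coefficient of the time-frequency shifts. -/
noncomputable def coeff (g f : L2 d) (z : PhaseSpace d) : ℂ := inner ℂ (rep z g) f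

lemma stft_eq_integral (g f : Space d → ℂ) (z : PhaseSpace d) :
    stft g f z = ∫ t, inner ℂ (tfShift z g t) (f t) := by
  refine integral_congr_ae (Filter.Eventually.of_forall fun t => ?_)
  simp only [tfShift_apply, RCLike.inner_apply, map_mul, conj_wave]
  rw [wave]
  simp only [inner_neg_left, Complex.ofReal_neg, mul_neg]
  ring

lemma coeff_eq_stft (g f : L2 d) (z : PhaseSpace d) : coeff g f z = stft g f z := by
  rw [stft_eq_integral, coeff, L2.inner_def]
  refine integral_congr_ae ?_
  filter_upwards [coeFn_rep z g] with t ht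
  rw [ht]

lemma stft_eq_coeff {g f : Space d → ℂ} (hg : MemLp g 2) (hf : MemLp f 2) (z : PhaseSpace d) :
    stft g f z = coeff (hg.toLp g) (hf.toLp f) z := by
  rw [stft_eq_integral, coeff, L2.inner_def]
  refine integral_congr_ae ?_
  filter_upwards [coeFn_rep z (hg.toLp g), tfShift_congr hg.coeFn_toLp z, hf.coeFn_toLp]
    with t h1 h2 h3
  rw [h1, h2, h3]

lemma continuous_coeff (g f : L2 d) : Continuous (coeff g f) :=
  (continuous_rep g).inner continuous_const

lemma norm_coeff_le (g f : L2 d) (z : PhaseSpace d) : ‖coeff g f z‖ ≤ ‖g‖ * ‖f‖ := by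
  rw [← norm_rep z g]; exact norm_inner_le_norm _ _

/-- The commutation relation of the time-frequency shifts. -/
lemma rep_comm (z w : PhaseSpace d) (f : L2 d) :
    rep z (rep w f) = (wave (-w.2) z.1 * wave z.2 w.1) • rep w (rep z f) := by
  rw [rep_rep, rep_rep, smul_smul, add_comm w z, mul_assoc, wave_mul_neg, mul_one]

/-- Composition is additive up to a phase, so Gram matrix entries of shifted windows are, in
modulus, samples of one short-time Fourier transform at differences. -/
lemma norm_inner_rep_rep (z w : PhaseSpace d) (f g : L2 d) :
    ‖(inner ℂ (rep z f) (rep w g) : ℂ)‖ = ‖coeff g f (w - z)‖ := by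
  have h := rep_rep z (w - z) g
  rw [add_sub_cancel] at h
  have h2 := congrArg (fun u => ‖(inner ℂ (rep z f) u : ℂ)‖) h
  simp only [inner_rep_rep, inner_smul_right, norm_mul, norm_wave, one_mul] at h2
  rw [← h2, coeff, norm_inner_symm]

/-! ### Plancherel for the Fourier integral on `L¹ ∩ L²`. -/

open scoped FourierTransform SchwartzMap

/-- On integrable square-integrable functions the Fourier transform on the Hilbert space is given by
the Fourier integral. -/
theorem coeFn_fourier_toLp {u : Space d → ℂ} (h1 : Integrable u) (h2 : MemLp u 2) :
    (𝓕 (h2.toLp u) : L2 d) =ᵐ[volume] 𝓕 u := by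
  have hloc1 : LocallyIntegrable (𝓕 (h2.toLp u) : L2 d) (volume : Measure (Space d)) :=
    (Lp.memLp _).locallyIntegrable one_le_two
  have hcont : Continuous (𝓕 u) := VectorFourier.fourierIntegral_continuous
    Real.continuous_fourierChar (by exact continuous_inner) h1
  have h0 := ae_eq_zero_of_integral_contDiff_smul_eq_zero (hloc1.sub hcont.locallyIntegrable) ?_
  · filter_upwards [h0] with t ht
    exact sub_eq_zero.1 ht
  intro φ hφ hφc
  have hg₁ : HasCompactSupport (Complex.ofRealCLM ∘ φ) := hφc.comp_left rfl
  have hg₂ : ContDiff ℝ (⊤ : ℕ∞) (Complex.ofRealCLM ∘ φ) := by fun_prop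
  set S : 𝓢(Space d, ℂ) := hg₁.toSchwartzMap hg₂ with hS
  have hSφ : ∀ t, S t = φ t := fun t => rfl
  -- Both transforms are moved onto the test function: one by the definition for tempered
  -- distributions, the other by the multiplication formula for integrable functions.
  have e1 : ∫ t, S t • (𝓕 (h2.toLp u) : L2 d) t = ∫ t, S t • 𝓕 u t := by
    have a1 := congrArg (fun T => T S) (Lp.fourier_toTemperedDistribution_eq (h2.toLp u))
    simp only [TemperedDistribution.fourier_apply, Lp.toTemperedDistribution_apply] at a1
    rw [← a1]
    have a2 := VectorFourier.integral_fourierIntegral_smul_eq_flip (e := Real.fourierChar)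
      (L := innerₗ (Space d)) (μ := volume) (ν := volume) (f := u) (g := S)
      Real.continuous_fourierChar (by exact continuous_inner) h1 S.integrable
    have a3 : (innerₗ (Space d)).flip = innerₗ (Space d) := by
      ext v w; simp
    rw [a3] at a2
    have a4 : ∫ t, S t • 𝓕 u t = ∫ t, 𝓕 u t • S t := by
      simp only [smul_eq_mul, mul_comm]
    rw [a4]
    refine Eq.trans ?_ a2.symm
    refine integral_congr_ae ?_
    filter_upwards [h2.coeFn_toLp] with t ht
    rw [ht, SchwartzMap.fourier_coe]
    simp only [smul_eq_mul, mul_comm]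
    rfl
  have i1 : Integrable fun t => φ t • (𝓕 (h2.toLp u) : L2 d) t :=
    hloc1.integrable_smul_left_of_hasCompactSupport hφ.continuous hφc
  have i2 : Integrable fun t => φ t • 𝓕 u t :=
    hcont.locallyIntegrable.integrable_smul_left_of_hasCompactSupport hφ.continuous hφc
  simp only [Pi.sub_apply, smul_sub]
  rw [integral_sub i1 i2, sub_eq_zero]
  simpa [hSφ] using e1

theorem memLp_fourier {u : Space d → ℂ} (h1 : Integrable u) (h2 : MemLp u 2) :
    MemLp (𝓕 u) 2 :=
  (memLp_congr_ae (coeFn_fourier_toLp h1 h2)).1 (Lp.memLp _)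

theorem integral_inner_fourier {u v : Space d → ℂ} (hu1 : Integrable u) (hu2 : MemLp u 2)
    (hv1 : Integrable v) (hv2 : MemLp v 2) :
    ∫ ω, inner ℂ (𝓕 u ω) (𝓕 v ω) = ∫ t, inner ℂ (u t) (v t) := by
  have h := Lp.inner_fourier_eq (hu2.toLp u) (hv2.toLp v)
  rw [L2.inner_def, L2.inner_def] at h
  refine Eq.trans (integral_congr_ae ?_) (h.trans (integral_congr_ae ?_))
  · filter_upwards [coeFn_fourier_toLp hu1 hu2, coeFn_fourier_toLp hv1 hv2] with t a b
    rw [a, b]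
  · filter_upwards [hu2.coeFn_toLp, hv2.coeFn_toLp] with t a b
    rw [a, b]

theorem lintegral_fourier_sq {u : Space d → ℂ} (h1 : Integrable u) (h2 : MemLp u 2) :
    ∫⁻ ω, ‖𝓕 u ω‖ₑ ^ 2 = ∫⁻ t, ‖u t‖ₑ ^ 2 := by
  have h := integral_inner_fourier h1 h2 h1 h2
  have key : ∀ {w : Space d → ℂ}, MemLp w 2 →
      ∫⁻ t, ‖w t‖ₑ ^ 2 = ENNReal.ofReal (∫ t, inner ℂ (w t) (w t) : ℂ).re := by
    intro w hw
    have hi := (memLp_two_iff_integrable_sq_norm hw.1).1 hw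
    have e : (∫ t, inner ℂ (w t) (w t) : ℂ) = ((∫ t, ‖w t‖ ^ 2 : ℝ) : ℂ) := by
      rw [← integral_complex_ofReal]
      refine integral_congr_ae (Filter.Eventually.of_forall fun t => ?_)
      simp only [inner_self_eq_norm_sq_to_K]
      push_cast; rfl
    rw [e, Complex.ofReal_re, ofReal_integral_eq_lintegral_ofReal hi
      (Filter.Eventually.of_forall fun t => by positivity)]
    refine lintegral_congr fun t => ?_
    rw [ENNReal.ofReal_pow (norm_nonneg _), ofReal_norm]
  rw [key (memLp_fourier h1 h2), key h2, h]

/-! ### Square-integrability and Moyal's identity. -/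

/-- The product of a function with a translate of a window. -/
noncomputable def windowed (g f : L2 d) (x t : Space d) : ℂ := f t * conj (g (t - x))

lemma integrable_windowed (g f : L2 d) (x : Space d) : Integrable (windowed g f x) := by
  have := L2.integrable_inner (𝕜 := ℂ) ((memLp_translate (Lp.memLp g) x).toLp _) f
  refine this.congr ?_
  filter_upwards [(memLp_translate (Lp.memLp g) x).coeFn_toLp] with t ht
  rw [ht, windowed, RCLike.inner_apply]

lemma coeff_eq_fourier (g f : L2 d) (x ω : Space d) :
    coeff g f (x, ω) = 𝓕 (windowed g f x) ω := by
  rw [coeff_eq_stft, stft, Real.fourier_eq']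
  refine integral_congr_ae (Filter.Eventually.of_forall fun t => ?_)
  simp only [windowed, smul_eq_mul, real_inner_comm ω t]
  rw [mul_comm]
  congr 2
  push_cast; ring

/-- Functions of `(t, t - x)` become pullbacks of products of one-variable functions, so a.e.
measurability and integrability transfer. -/
lemma measurePreserving_shear :
    MeasurePreserving (fun p : Space d × Space d => (p.1, p.1 - p.2))
      (volume.prod volume) (volume.prod volume) := by
  refine (MeasurePreserving.id volume).skew_product (g := fun x y => x - y) (by fun_prop) ?_
  exact Filter.Eventually.of_forall fun x => (volume.measurePreserving_sub_left x).map_eq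

lemma aestronglyMeasurable_windowed (g f : L2 d) :
    AEStronglyMeasurable (fun p : Space d × Space d => windowed g f p.1 p.2)
      (volume.prod volume) := by
  have h : AEStronglyMeasurable (fun p : Space d × Space d => f p.1 * conj (g p.2))
      (volume.prod volume) := by
    have h2 : AEStronglyMeasurable (fun t => conj (g t)) (volume : Measure (Space d)) :=
      (Complex.continuous_conj.comp_aestronglyMeasurable (Lp.memLp g).1)
    exact (Lp.memLp f).1.comp_fst.mul h2.comp_snd
  have h2 := h.comp_measurePreserving measurePreserving_shear
  exact h2.comp_measurePreserving (Measure.measurePreserving_swap)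

lemma lintegral_windowed (g f : L2 d) :
    ∫⁻ x, ∫⁻ t, ‖windowed g f x t‖ₑ ^ 2 = (∫⁻ t, ‖f t‖ₑ ^ 2) * ∫⁻ t, ‖g t‖ₑ ^ 2 := by
  rw [lintegral_lintegral_swap ((aestronglyMeasurable_windowed g f).enorm.pow_const 2)]
  simp only [windowed, enorm_mul, mul_pow, RCLike.enorm_conj]
  have hf : AEMeasurable (fun t => ‖f t‖ₑ ^ 2) (volume : Measure (Space d)) :=
    (Lp.memLp f).1.enorm.pow_const 2
  have hg : AEMeasurable (fun t => ‖g t‖ₑ ^ 2) (volume : Measure (Space d)) :=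
    (Lp.memLp g).1.enorm.pow_const 2
  have : ∀ t : Space d, ∫⁻ x, ‖f t‖ₑ ^ 2 * ‖g (t - x)‖ₑ ^ 2
      = ‖f t‖ₑ ^ 2 * ∫⁻ x, ‖g x‖ₑ ^ 2 := by
    intro t
    rw [lintegral_const_mul' _ _ (by simp)]
    congr 1
    exact lintegral_sub_left_eq_self (fun x => ‖g x‖ₑ ^ 2) t
  simp only [this]
  rw [lintegral_mul_const'' _ hf]

lemma lintegral_sq_lt_top (f : L2 d) : ∫⁻ t, ‖f t‖ₑ ^ 2 < ⊤ := by
  have := ((memLp_two_iff_integrable_sq_norm (Lp.memLp f).1).1 (Lp.memLp f)).2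
  rw [hasFiniteIntegral_iff_enorm] at this
  simpa [enorm_pow] using this

lemma memLp_two_of_lintegral {α : Type*} [MeasurableSpace α] {μ : Measure α} {u : α → ℂ}
    (hm : AEStronglyMeasurable u μ) (h : ∫⁻ t, ‖u t‖ₑ ^ 2 ∂μ < ⊤) : MemLp u 2 μ := by
  rw [memLp_two_iff_integrable_sq_norm hm]
  refine ⟨hm.norm.pow 2, ?_⟩
  rw [hasFiniteIntegral_iff_enorm]
  simpa [enorm_pow] using h

/-- A product of two `L²` functions need not be in `L²`. Tonelli shows that it is for almost every
translate, which is enough to apply Plancherel under the integral in `x`. -/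
lemma ae_memLp_windowed (g f : L2 d) : ∀ᵐ x : Space d, MemLp (windowed g f x) 2 := by
  have h1 : ∫⁻ x, ∫⁻ t, ‖windowed g f x t‖ₑ ^ 2 ≠ ⊤ := by
    rw [lintegral_windowed]
    exact ENNReal.mul_ne_top (lintegral_sq_lt_top f).ne (lintegral_sq_lt_top g).ne
  have hm := ((aestronglyMeasurable_windowed g f).enorm.pow_const 2).lintegral_prod_right'
  filter_upwards [ae_lt_top' hm h1] with x hx
  exact memLp_two_of_lintegral (integrable_windowed g f x).1 hx

/-- For almost every fixed `x` this is Plancherel in `ω`; integrating in `x` gives a product of two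
finite norms. It supplies the integrability that Fubini needs in Moyal's identity. -/
theorem memLp_coeff (g f : L2 d) : MemLp (coeff g f) 2 := by
  refine memLp_two_of_lintegral (continuous_coeff g f).aestronglyMeasurable ?_
  have : ∫⁻ z, ‖coeff g f z‖ₑ ^ 2 = ∫⁻ x, ∫⁻ t, ‖windowed g f x t‖ₑ ^ 2 := by
    rw [Measure.volume_eq_prod, lintegral_prod _
      ((continuous_coeff g f).aestronglyMeasurable.enorm.pow_const 2)]
    refine lintegral_congr_ae ?_
    filter_upwards [ae_memLp_windowed g f] with x hx
    simp only [coeff_eq_fourier]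
    exact lintegral_fourier_sq (integrable_windowed g f x) hx
  rw [this, lintegral_windowed]
  exact ENNReal.mul_lt_top (lintegral_sq_lt_top f) (lintegral_sq_lt_top g)

lemma integrable_coeff_mul (g₁ f₁ g₂ f₂ : L2 d) :
    Integrable fun z => coeff g₁ f₁ z * conj (coeff g₂ f₂ z) :=
  (memLp_coeff g₁ f₁).integrable_mul (memLp_coeff g₂ f₂).star

lemma integrable_mul_conj (f g : L2 d) : Integrable fun t => f t * conj (g t) := by
  simpa [RCLike.inner_apply] using L2.integrable_inner (𝕜 := ℂ) g f

/-- Orthogonality relations (Moyal's identity). -/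
theorem integral_coeff_mul (g₁ f₁ g₂ f₂ : L2 d) :
    ∫ z, coeff g₁ f₁ z * conj (coeff g₂ f₂ z) = inner ℂ f₂ f₁ * inner ℂ g₁ g₂ := by
  have hprod : Integrable (fun p : Space d × Space d =>
      (f₁ p.1 * conj (f₂ p.1)) * (g₂ p.2 * conj (g₁ p.2))) (volume.prod volume) :=
    (integrable_mul_conj f₁ f₂).mul_prod (integrable_mul_conj g₂ g₁)
  have hshear : Integrable (fun p : Space d × Space d =>
      (f₁ p.1 * conj (f₂ p.1)) * (g₂ (p.1 - p.2) * conj (g₁ (p.1 - p.2))))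
      (volume.prod volume) := measurePreserving_shear.integrable_comp_of_integrable hprod
  rw [Measure.volume_eq_prod, integral_prod _ (by
    rw [← Measure.volume_eq_prod]; exact integrable_coeff_mul g₁ f₁ g₂ f₂)]
  calc ∫ x : Space d, ∫ ω : Space d, coeff g₁ f₁ (x, ω) * conj (coeff g₂ f₂ (x, ω))
      = ∫ x : Space d, ∫ t : Space d,
          (f₁ t * conj (f₂ t)) * (g₂ (t - x) * conj (g₁ (t - x))) := by
        refine integral_congr_ae ?_
        filter_upwards [ae_memLp_windowed g₁ f₁, ae_memLp_windowed g₂ f₂] with x h1 h2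
        have := integral_inner_fourier (integrable_windowed g₂ f₂ x) h2
          (integrable_windowed g₁ f₁ x) h1
        simp only [RCLike.inner_apply] at this
        simp only [coeff_eq_fourier]
        rw [this]
        refine integral_congr_ae (Filter.Eventually.of_forall fun t => ?_)
        simp only [windowed, map_mul, Complex.conj_conj]
        ring
    _ = ∫ t : Space d, ∫ x : Space d,
          (f₁ t * conj (f₂ t)) * (g₂ (t - x) * conj (g₁ (t - x))) :=
        (integral_integral_swap hshear).symm
    _ = ∫ t : Space d, (f₁ t * conj (f₂ t)) * ∫ x : Space d, g₂ x * conj (g₁ x) := by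
        refine integral_congr_ae (Filter.Eventually.of_forall fun t => ?_)
        simp only
        rw [integral_const_mul]
        congr 1
        exact integral_sub_left_eq_self (fun x => g₂ x * conj (g₁ x)) volume t
    _ = _ := by
        rw [integral_mul_const, L2.inner_def, L2.inner_def]
        simp only [RCLike.inner_apply]

/-! ### Convolution domination. -/

instance : (volume : Measure (PhaseSpace d)).IsAddHaarMeasure :=
  inferInstanceAs (volume.prod volume : Measure (Space d × Space d)).IsAddHaarMeasure

instance : (volume : Measure (PhaseSpace d)).IsNegInvariant :=
  Measure.IsAddHaarMeasure.isNegInvariant_of_regular volume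

lemma norm_coeff_symm (g f : L2 d) (z : PhaseSpace d) : ‖coeff g f z‖ = ‖coeff f g (-z)‖ := by
  have := norm_inner_rep_rep z 0 g f
  rwa [rep_zero, zero_sub] at this

lemma norm_coeff_rep_left (u : PhaseSpace d) (g f : L2 d) (w : PhaseSpace d) :
    ‖coeff (rep u g) f w‖ = ‖coeff g f (w + u)‖ := by
  rw [coeff, rep_rep, inner_smul_left, norm_mul, RCLike.norm_conj, norm_wave, one_mul, coeff]

lemma norm_coeff_rep_rep (u : PhaseSpace d) (g f : L2 d) (w : PhaseSpace d) :
    ‖coeff (rep u g) (rep u f) w‖ = ‖coeff g f w‖ := by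
  rw [norm_coeff_rep_left, coeff, norm_inner_rep_rep, norm_coeff_symm g f]
  congr 2; abel

/-- Every short-time Fourier transform is dominated by a convolution of two others. -/
theorem enorm_coeff_le_convolution (g₁ g₂ f h : L2 d) (w : PhaseSpace d) :
    ‖(inner ℂ g₁ g₂ : ℂ)‖ₑ * ‖coeff h f w‖ₑ
      ≤ ∫⁻ z, ‖coeff g₁ f z‖ₑ * ‖coeff h g₂ (w - z)‖ₑ := by
  -- With `π(w) h` in the last slot, Moyal's identity reproduces `coeff h f w` times a constant; the
  -- triangle inequality turns it into a convolution bound.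
  have h1 := integral_coeff_mul g₁ f g₂ (rep w h)
  have h2 := enorm_integral_le_lintegral_enorm (μ := volume)
    (fun z => coeff g₁ f z * conj (coeff g₂ (rep w h) z))
  rw [h1, enorm_mul, mul_comm] at h2
  refine h2.trans (lintegral_mono fun z => ?_)
  rw [enorm_mul]
  have : ‖conj (coeff g₂ (rep w h) z)‖ₑ = ‖coeff h g₂ (w - z)‖ₑ := by
    rw [RCLike.enorm_conj, ← ofReal_norm, ← ofReal_norm, coeff, norm_inner_rep_rep]
  rw [this]

/-- Tonelli for convolutions of nonnegative functions. -/
lemma lintegral_tsum_convolution {ι : Type*} [Countable ι] {a b : PhaseSpace d → ENNReal}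
    (ha : Measurable a) (hb : Measurable b) (p : ι → PhaseSpace d) {K : ENNReal}
    (hK : ∀ u, ∑' i, b (p i - u) ≤ K) :
    ∑' i, ∫⁻ z, a z * b (p i - z) ≤ (∫⁻ z, a z) * K := by
  have hm : ∀ i, AEMeasurable fun z => a z * b (p i - z) := fun i => by fun_prop
  rw [← lintegral_tsum hm]
  rw [← lintegral_mul_const _ ha]
  refine lintegral_mono fun z => ?_
  rw [ENNReal.tsum_mul_left]
  gcongr
  exact hK z

lemma lintegral_convolution {a b : PhaseSpace d → ENNReal}
    (ha : Measurable a) (hb : Measurable b) :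
    ∫⁻ w, ∫⁻ z, a z * b (w - z) = (∫⁻ z, a z) * ∫⁻ z, b z := by
  rw [lintegral_lintegral_swap ((ha.comp measurable_snd).mul
    (hb.comp (measurable_fst.sub measurable_snd))).aemeasurable]
  rw [← lintegral_mul_const _ ha]
  refine lintegral_congr fun z => ?_
  have hm : Measurable fun w => b (w - z) := by fun_prop
  rw [lintegral_const_mul _ hm]
  congr 1
  exact lintegral_sub_right_eq_self b z

lemma measurable_enorm_coeff (g f : L2 d) : Measurable fun z => ‖coeff g f z‖ₑ :=
  (continuous_coeff g f).enorm.measurable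

/-! ### Gaussian decay and a Gaussian window. -/

/-- The standard Gaussian on the time-frequency plane with width parameter `a`. -/
noncomputable def planeGaussian (a : ℝ) (z : PhaseSpace d) : ℝ :=
  Real.exp (-a * ‖z.1‖ ^ 2) * Real.exp (-a * ‖z.2‖ ^ 2)

lemma continuous_planeGaussian (a : ℝ) : Continuous (planeGaussian (d := d) a) := by
  unfold planeGaussian; fun_prop

lemma integrable_gaussian {a : ℝ} (ha : 0 < a) :
    Integrable fun x : Space d => Real.exp (-a * ‖x‖ ^ 2) := by
  have := (GaussianFourier.integrable_cexp_neg_mul_sq_norm_add (V := Space d) (b := (a : ℂ))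
    (by simpa using ha) 0 0).norm
  refine this.congr (Filter.Eventually.of_forall fun x => ?_)
  simp only [Complex.norm_exp]
  congr 1
  rw [zero_mul, add_zero, ← Complex.ofReal_pow, ← Complex.ofReal_neg, ← Complex.ofReal_mul,
    Complex.ofReal_re]

lemma lintegral_planeGaussian_lt_top {a : ℝ} (ha : 0 < a) :
    ∫⁻ z : PhaseSpace d, ENNReal.ofReal (planeGaussian a z) < ⊤ := by
  have h : Integrable (planeGaussian (d := d) a) :=
    (integrable_gaussian (d := d) ha).mul_prod (integrable_gaussian (d := d) ha)
  have := h.2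
  rw [hasFiniteIntegral_iff_enorm] at this
  refine lt_of_eq_of_lt (lintegral_congr fun z => ?_) this
  rw [Real.enorm_eq_ofReal (by unfold planeGaussian; positivity)]

/-- Halving the exponent absorbs a bounded displacement, so a point value is controlled by the wider
Gaussian throughout a ball, and sums over separated points by an integral. -/
lemma planeGaussian_le_near {r : ℝ} {z w : PhaseSpace d} (h : ‖w - z‖ ≤ r) :
    planeGaussian (1 / 2) z ≤ Real.exp (r ^ 2) * planeGaussian (1 / 4) w := by
  -- From `‖y‖² ≤ (‖x‖ + r)² ≤ 2‖x‖² + 2r²`; the two components together contribute `r²`.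
  have aux : ∀ x y : Space d, ‖y - x‖ ≤ r →
      -(1 / 2) * ‖x‖ ^ 2 ≤ r ^ 2 / 2 + -(1 / 4) * ‖y‖ ^ 2 := by
    intro x y hxy
    have h1 : ‖y‖ ≤ ‖x‖ + r := by
      have := norm_le_norm_add_norm_sub x y
      rw [norm_sub_rev] at this; linarith
    nlinarith [norm_nonneg x, norm_nonneg y, sq_nonneg (‖x‖ - r)]
  have h1 := aux z.1 w.1 ((norm_fst_le (w - z)).trans h)
  have h2 := aux z.2 w.2 ((norm_snd_le (w - z)).trans h)
  rw [planeGaussian, planeGaussian, ← Real.exp_add, ← Real.exp_add, ← Real.exp_add]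
  apply Real.exp_le_exp.2
  linarith

/-- The sums of a Gaussian over the translates of a separated family are uniformly bounded. -/
lemma exists_tsum_planeGaussian_le {ι : Type*} [Countable ι] {p : ι → PhaseSpace d} {r : ℝ}
    (hr : 0 < r) (hp : Pairwise fun i j => Disjoint (Metric.ball (p i) r) (Metric.ball (p j) r)) :
    ∃ K : ENNReal, K ≠ ⊤ ∧ ∀ u,
      ∑' i, ENNReal.ofReal (planeGaussian (1 / 2) (p i - u)) ≤ K := by
  set v := volume (Metric.ball (0 : PhaseSpace d) r) with hv
  have hv0 : v ≠ 0 := (Metric.measure_ball_pos _ _ hr).ne'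
  have hvt : v ≠ ⊤ := measure_ball_lt_top.ne
  set I := ∫⁻ z : PhaseSpace d, ENNReal.ofReal (planeGaussian (1 / 4) z) with hI
  have hIt : I ≠ ⊤ := (lintegral_planeGaussian_lt_top (by norm_num)).ne
  refine ⟨ENNReal.ofReal (Real.exp (r ^ 2)) * I / v,
    ENNReal.div_ne_top (ENNReal.mul_ne_top ENNReal.ofReal_ne_top hIt) hv0, fun u => ?_⟩
  rw [ENNReal.le_div_iff_mul_le (Or.inl hv0) (Or.inl hvt), ← ENNReal.tsum_mul_right]
  set G : PhaseSpace d → ENNReal := fun z =>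
    ENNReal.ofReal (Real.exp (r ^ 2)) * ENNReal.ofReal (planeGaussian (1 / 4) (z - u)) with hG
  have hmeas : Measurable fun z : PhaseSpace d => ENNReal.ofReal (planeGaussian (1 / 4) z) :=
    (continuous_planeGaussian _).measurable.ennreal_ofReal
  calc ∑' i, ENNReal.ofReal (planeGaussian (1 / 2) (p i - u)) * v
      ≤ ∑' i, ∫⁻ z in Metric.ball (p i) r, G z := by
        refine ENNReal.tsum_le_tsum fun i => ?_
        have e : v = volume (Metric.ball (p i) r) :=
          (Measure.addHaar_ball_center volume (p i) r).symm
        rw [e, ← setLIntegral_const]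
        refine setLIntegral_mono' Metric.isOpen_ball.measurableSet fun z hz => ?_
        simp only [hG]
        rw [← ENNReal.ofReal_mul (Real.exp_pos _).le]
        refine ENNReal.ofReal_le_ofReal (planeGaussian_le_near ?_)
        rw [sub_sub_sub_cancel_right, ← dist_eq_norm]
        exact (Metric.mem_ball.1 hz).le
    _ = ∫⁻ z in ⋃ i, Metric.ball (p i) r, G z :=
        (lintegral_iUnion (fun i => Metric.isOpen_ball.measurableSet) hp _).symm
    _ ≤ ∫⁻ z, G z := setLIntegral_le_lintegral _ _
    _ = ENNReal.ofReal (Real.exp (r ^ 2)) * I := by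
        have hm : Measurable fun z : PhaseSpace d =>
          ENNReal.ofReal (planeGaussian (1 / 4) (z - u)) :=
            hmeas.comp (measurable_id.sub_const u)
        rw [lintegral_const_mul _ hm]
        congr 1
        exact lintegral_sub_right_eq_self
          (fun z : PhaseSpace d => ENNReal.ofReal (planeGaussian (1 / 4) z)) u

/-- There is a nonzero window whose short-time Fourier transform has Gaussian decay. -/
theorem exists_gaussian_window : ∃ φ : L2 d, φ ≠ 0 ∧
    ∃ C : ℝ, ∀ z, ‖coeff φ φ z‖ ≤ C * planeGaussian (1 / 2) z := by
  set f : Space d → ℂ := fun t => (Real.exp (-1 * ‖t‖ ^ 2) : ℝ) with hf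
  have hfc : Continuous f := by fun_prop
  have hL : MemLp f 2 := by
    rw [memLp_two_iff_integrable_sq_norm hfc.aestronglyMeasurable]
    refine (integrable_gaussian (d := d) (a := 2) two_pos).congr
      (Filter.Eventually.of_forall fun t => ?_)
    simp only [hf, Complex.norm_real, Real.norm_of_nonneg (Real.exp_pos _).le]
    rw [← Real.exp_nat_mul]; congr 1; push_cast; ring
  have hne : hL.toLp f ≠ 0 := by
    intro h0
    have h1 := (Lp.eq_zero_iff_ae_eq_zero.1 h0)
    have h2 := hL.coeFn_toLp.symm.trans h1
    have h3 := (Continuous.ae_eq_iff_eq volume hfc continuous_zero).1 h2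
    have := congrFun h3 0
    simp [hf] at this
  refine ⟨hL.toLp f, hne, ‖((Real.pi / 2 : ℂ) ^ (Module.finrank ℝ (Space d) / 2 : ℂ))‖,
    fun z => ?_⟩
  -- Recentring the integral at the midpoint `z.1 / 2` makes the product of the two Gaussians split
  -- by the parallelogram law into a factor in `z.1` and a Gaussian in `t`.
  have key : coeff (hL.toLp f) (hL.toLp f) z = wave (-z.2) ((1 / 2 : ℝ) • z.1) *
      ((Real.exp (-(1 / 2) * ‖z.1‖ ^ 2) : ℝ) : ℂ) * 𝓕 (fun v : Space d =>
        Complex.exp (-(2 : ℂ) * ‖v‖ ^ 2)) z.2 := by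
    rw [← stft_eq_coeff hL hL, stft,
      ← integral_add_right_eq_self _ ((1 / 2 : ℝ) • z.1), Real.fourier_eq', ← integral_const_mul]
    refine integral_congr_ae (Filter.Eventually.of_forall fun t => ?_)
    have e1 : ∀ s, Complex.exp (-(2 * Real.pi * Complex.I * (inner ℝ z.2 s : ℝ))) =
        wave (-z.2) s := by
      intro s; rw [wave]; simp
    simp only [e1, wave_add_right]
    have e2 : Complex.exp (((-2 * Real.pi * inner ℝ t z.2 : ℝ) : ℂ) * Complex.I)
        = wave (-z.2) t := by
      rw [wave, inner_neg_left, real_inner_comm t z.2]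
      congr 1; push_cast; ring
    have e3 : f (t + (1 / 2 : ℝ) • z.1) * conj (f (t + (1 / 2 : ℝ) • z.1 - z.1)) =
        ((Real.exp (-(1 / 2) * ‖z.1‖ ^ 2) : ℝ) : ℂ) * Complex.exp (-(2 : ℂ) * ‖t‖ ^ 2) := by
      have e4 : t + (1 / 2 : ℝ) • z.1 - z.1 = t - (1 / 2 : ℝ) • z.1 := by module
      have e5 : Complex.exp (-(2 : ℂ) * ‖t‖ ^ 2) = ((Real.exp (-2 * ‖t‖ ^ 2) : ℝ) : ℂ) := by
        push_cast; rfl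
      rw [e4, e5]
      simp only [hf, Complex.conj_ofReal]
      rw [← Complex.ofReal_mul, ← Complex.ofReal_mul, ← Real.exp_add, ← Real.exp_add]
      congr 2
      have := parallelogram_law_with_norm ℝ t ((1 / 2 : ℝ) • z.1)
      have h6 : ‖(1 / 2 : ℝ) • z.1‖ = 1 / 2 * ‖z.1‖ := by
        rw [norm_smul]; norm_num
      rw [h6] at this
      nlinarith
    rw [e3, smul_eq_mul, e2]
    ring
  rw [key, fourier_gaussian_innerProductSpace (by norm_num)]
  rw [norm_mul, norm_mul, norm_wave, one_mul, norm_mul, Complex.norm_real,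
    Real.norm_of_nonneg (Real.exp_pos _).le, planeGaussian]
  -- The true rate `π² / 2` is weakened to `1 / 2`, matching the decay in `z.1`.
  have h7 : ‖Complex.exp (-(Real.pi : ℂ) ^ 2 * ‖z.2‖ ^ 2 / 2)‖
      ≤ Real.exp (-(1 / 2) * ‖z.2‖ ^ 2) := by
    have : (-(Real.pi : ℂ) ^ 2 * ‖z.2‖ ^ 2 / 2)
        = ((-Real.pi ^ 2 * ‖z.2‖ ^ 2 / 2 : ℝ) : ℂ) := by push_cast; ring
    rw [Complex.norm_exp, this, Complex.ofReal_re]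
    apply Real.exp_le_exp.2
    have : (1 : ℝ) ≤ Real.pi ^ 2 := by nlinarith [Real.pi_gt_three]
    nlinarith [sq_nonneg ‖z.2‖]
  have := mul_le_mul_of_nonneg_left h7 (mul_nonneg
    (Real.exp_pos (-(1 / 2) * ‖z.1‖ ^ 2)).le (norm_nonneg
      ((Real.pi / 2 : ℂ) ^ (Module.finrank ℝ (Space d) / 2 : ℂ))))
  linarith

/-! ### Integrability and summability for windows in Feichtinger's algebra. -/

lemma lintegral_coeff_symm (g f : L2 d) :
    ∫⁻ z, ‖coeff g f z‖ₑ = ∫⁻ z, ‖coeff f g z‖ₑ := by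
  rw [← lintegral_neg_eq_self (μ := volume) fun z => ‖coeff f g z‖ₑ]
  refine lintegral_congr fun z => ?_
  rw [← ofReal_norm, norm_coeff_symm, ofReal_norm]

/-- Two vectors with integrable diagonal coefficients have an integrable mixed coefficient. -/
theorem lintegral_coeff_lt_top {φ g : L2 d} (hφ : ∫⁻ z, ‖coeff φ φ z‖ₑ < ⊤)
    (hg : ∫⁻ z, ‖coeff g g z‖ₑ < ⊤) : ∫⁻ z, ‖coeff φ g z‖ₑ < ⊤ := by
  by_cases h0 : ∀ u, coeff φ g u = 0
  · simp [h0]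
  push Not at h0
  obtain ⟨u, hu⟩ := h0
  have hc : ‖(inner ℂ g (rep u φ) : ℂ)‖ₑ ≠ 0 := by
    rw [enorm_ne_zero]
    intro h
    exact hu (by rw [coeff, ← inner_conj_symm, h, map_zero])
  -- The convolution bound is useful only with a nonzero constant; `g` and `φ` may be orthogonal, so
  -- `φ` is first shifted by `u`. The shift changes none of the integrals.
  have hb := lintegral_mono (μ := volume) fun w =>
    enorm_coeff_le_convolution g (rep u φ) g (rep u φ) w
  rw [lintegral_const_mul _ (measurable_enorm_coeff _ _),
    lintegral_convolution (measurable_enorm_coeff _ _) (measurable_enorm_coeff _ _)] at hb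
  have e1 : ∫⁻ w, ‖coeff (rep u φ) g w‖ₑ = ∫⁻ w, ‖coeff φ g w‖ₑ := by
    rw [← lintegral_add_right_eq_self (fun w => ‖coeff φ g w‖ₑ) u]
    refine lintegral_congr fun z => ?_
    rw [← ofReal_norm, norm_coeff_rep_left, ofReal_norm]
  have e2 : ∫⁻ w, ‖coeff (rep u φ) (rep u φ) w‖ₑ = ∫⁻ w, ‖coeff φ φ w‖ₑ := by
    refine lintegral_congr fun z => ?_
    rw [← ofReal_norm, norm_coeff_rep_rep, ofReal_norm]
  rw [e1, e2] at hb
  by_contra htop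
  rw [not_lt, top_le_iff] at htop
  rw [htop, ENNReal.mul_top hc] at hb
  exact (ENNReal.mul_lt_top hg hφ).not_ge hb

/-- Short-time Fourier transforms between vectors of Feichtinger's algebra are summable over
separated families. -/
theorem tsum_coeff_ne_top {ι : Type*} [Countable ι] {p : ι → PhaseSpace d} {r : ℝ}
    (hr : 0 < r) (hp : Pairwise fun i j => Disjoint (Metric.ball (p i) r) (Metric.ball (p j) r))
    {g g' : L2 d} (hg : ∫⁻ z, ‖coeff g g z‖ₑ < ⊤) (hg' : ∫⁻ z, ‖coeff g' g' z‖ₑ < ⊤) :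
    ∑' i, ‖coeff g g' (p i)‖ₑ ≠ ⊤ := by
  obtain ⟨φ, hφ0, C, hC⟩ := exists_gaussian_window (d := d)
  obtain ⟨K, hK, hsum⟩ := exists_tsum_planeGaussian_le hr hp
  have hCb : ∀ z, ‖coeff φ φ z‖ₑ
      ≤ ENNReal.ofReal C * ENNReal.ofReal (planeGaussian (1 / 2) z) := by
    intro z
    rw [← ENNReal.ofReal_mul' (by unfold planeGaussian; positivity), ← ofReal_norm]
    exact ENNReal.ofReal_le_ofReal (hC z)
  have hφ : ∫⁻ z, ‖coeff φ φ z‖ₑ < ⊤ := by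
    refine (lintegral_mono hCb).trans_lt ?_
    rw [lintegral_const_mul' _ _ ENNReal.ofReal_ne_top]
    exact ENNReal.mul_lt_top ENNReal.ofReal_lt_top
      (lintegral_planeGaussian_lt_top (by norm_num))
  have hφsum : ∀ u, ∑' i, ‖coeff φ φ (p i - u)‖ₑ ≤ ENNReal.ofReal C * K := by
    intro u
    refine (ENNReal.tsum_le_tsum fun i => hCb _).trans ?_
    rw [ENNReal.tsum_mul_left]
    gcongr
    exact hsum u
  set c := ‖(inner ℂ φ φ : ℂ)‖ₑ with hc
  have hc0 : c ≠ 0 := by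
    rw [hc, enorm_ne_zero]; exact inner_self_ne_zero.2 hφ0
  have hct : c ≠ ⊤ := enorm_ne_top
  -- The Gaussian supplies uniform sums over translated families. One convolution bound passes this
  -- to `coeff φ g'`, and `step2` passes it on to `coeff g g'`.
  have step1 : ∀ u, ∑' i, ‖coeff φ g' (p i - u)‖ₑ
      ≤ (∫⁻ z, ‖coeff φ g' z‖ₑ) * (ENNReal.ofReal C * K) / c := by
    intro u
    rw [ENNReal.le_div_iff_mul_le (Or.inl hc0) (Or.inl hct), mul_comm, ← ENNReal.tsum_mul_left]
    refine (ENNReal.tsum_le_tsum fun i =>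
      enorm_coeff_le_convolution φ φ g' φ (p i - u)).trans ?_
    refine lintegral_tsum_convolution (measurable_enorm_coeff _ _) (measurable_enorm_coeff _ _)
      (fun i => p i - u) fun v => ?_
    simp only [sub_sub]
    exact hφsum _
  set B := (∫⁻ z, ‖coeff φ g' z‖ₑ) * (ENNReal.ofReal C * K) / c with hB
  have hBt : B ≠ ⊤ := ENNReal.div_ne_top (ENNReal.mul_ne_top (lintegral_coeff_lt_top hφ hg').ne
    (ENNReal.mul_ne_top ENNReal.ofReal_ne_top hK)) hc0
  have step2 : c * ∑' i, ‖coeff g g' (p i)‖ₑ ≤ (∫⁻ z, ‖coeff φ g z‖ₑ) * B := by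
    rw [← ENNReal.tsum_mul_left, ← lintegral_coeff_symm]
    refine (ENNReal.tsum_le_tsum fun i => enorm_coeff_le_convolution φ φ g' g (p i)).trans ?_
    have hflip : ∀ i, ∫⁻ z, ‖coeff φ g' z‖ₑ * ‖coeff g φ (p i - z)‖ₑ
        = ∫⁻ z, ‖coeff g φ z‖ₑ * ‖coeff φ g' (p i - z)‖ₑ := by
      intro i
      rw [← lintegral_sub_left_eq_self (μ := volume) _ (p i)]
      refine lintegral_congr fun z => ?_
      rw [sub_sub_cancel, mul_comm]
    simp only [hflip]
    exact lintegral_tsum_convolution (measurable_enorm_coeff _ _) (measurable_enorm_coeff _ _)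
      p step1
  intro htop
  rw [htop, ENNReal.mul_top hc0, top_le_iff] at step2
  exact ENNReal.mul_ne_top (lintegral_coeff_lt_top hφ hg).ne hBt step2

/-! ### Bessel sequences and their analysis operators. -/

section Bessel

variable {H : Type*} [NormedAddCommGroup H] [InnerProductSpace ℂ H] {κ : Type*}

/-- Schur's test for the Gram matrix gives a Bessel bound. -/
theorem sum_sq_norm_inner_le (u : κ → H) {C : ℝ} (hC0 : 0 ≤ C)
    (hC : ∀ (s : Finset κ) (n : κ), ∑ m ∈ s, ‖(inner ℂ (u n) (u m) : ℂ)‖ ≤ C)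
    (f : H) (s : Finset κ) : ∑ n ∈ s, ‖(inner ℂ (u n) f : ℂ)‖ ^ 2 ≤ C * ‖f‖ ^ 2 := by
  set a : κ → ℂ := fun n => inner ℂ (u n) f with ha
  set S := ∑ n ∈ s, ‖a n‖ ^ 2 with hS
  set v := ∑ n ∈ s, a n • u n with hv
  have hS0 : 0 ≤ S := Finset.sum_nonneg fun n _ => by positivity
  have h1 : (inner ℂ v f : ℂ) = (S : ℂ) := by
    rw [hv, sum_inner, hS, Complex.ofReal_sum]
    refine Finset.sum_congr rfl fun n _ => ?_
    rw [inner_smul_left, ← Complex.normSq_eq_norm_sq, Complex.normSq_eq_conj_mul_self]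
  -- Together with `‖v‖² ≤ S * C` this gives `S² ≤ S * (C * ‖f‖²)`, from which one factor `S`
  -- cancels.
  have h2 : S ≤ ‖v‖ * ‖f‖ := by
    have := norm_inner_le_norm (𝕜 := ℂ) v f
    rwa [h1, Complex.norm_real, Real.norm_of_nonneg hS0] at this
  have h3 : ‖v‖ ^ 2 ≤ S * C := by
    have e : (inner ℂ v v : ℂ) = ∑ n ∈ s, ∑ m ∈ s, conj (a n) * (a m * inner ℂ (u n) (u m)) := by
      rw [hv, sum_inner]
      refine Finset.sum_congr rfl fun n _ => ?_
      rw [inner_smul_left, inner_sum, Finset.mul_sum]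
      refine Finset.sum_congr rfl fun m _ => ?_
      rw [inner_smul_right]
    have e2 : ‖v‖ ^ 2 = ‖(inner ℂ v v : ℂ)‖ := by
      rw [inner_self_eq_norm_sq_to_K]; simp
    rw [e2, e]
    refine (norm_sum_le _ _).trans ((Finset.sum_le_sum fun n _ => norm_sum_le _ _).trans ?_)
    -- Since `‖a n‖ ‖a m‖ ≤ (‖a n‖² + ‖a m‖²) / 2` and the Gram matrix is symmetric in modulus, only
    -- row sums are needed.
    have hle : ∀ n ∈ s, ∀ m ∈ s, ‖conj (a n) * (a m * inner ℂ (u n) (u m))‖ ≤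
        1 / 2 * (‖a n‖ ^ 2 * ‖(inner ℂ (u n) (u m) : ℂ)‖) +
        1 / 2 * (‖a m‖ ^ 2 * ‖(inner ℂ (u m) (u n) : ℂ)‖) := by
      intro n _ m _
      rw [norm_mul, norm_mul, RCLike.norm_conj, norm_inner_symm (u m) (u n)]
      nlinarith [mul_nonneg (sq_nonneg (‖a n‖ - ‖a m‖)) (norm_nonneg (inner ℂ (u n) (u m) : ℂ))]
    refine (Finset.sum_le_sum fun n hn => Finset.sum_le_sum (hle n hn)).trans ?_
    have hrow : ∑ n ∈ s, ∑ m ∈ s, ‖a n‖ ^ 2 * ‖(inner ℂ (u n) (u m) : ℂ)‖ ≤ S * C := by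
      rw [hS, Finset.sum_mul]
      refine Finset.sum_le_sum fun n _ => ?_
      rw [← Finset.mul_sum]
      exact mul_le_mul_of_nonneg_left (hC s n) (by positivity)
    have hcol := hrow
    rw [Finset.sum_comm] at hcol
    simp only [Finset.sum_add_distrib, ← Finset.mul_sum] at hrow hcol ⊢
    linarith
  rcases hS0.eq_or_lt with h0 | h0
  · rw [← h0]; positivity
  · have h4 : S * S ≤ S * (C * ‖f‖ ^ 2) := by
      have := mul_self_le_mul_self hS0 h2
      nlinarith [sq_nonneg ‖f‖]
    exact le_of_mul_le_mul_left h4 h0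

/-- The analysis operator of a Bessel sequence. -/
theorem exists_analysis_operator (u : κ → H) {C : ℝ} (hC0 : 0 ≤ C)
    (hC : ∀ (f : H) (s : Finset κ), ∑ n ∈ s, ‖(inner ℂ (u n) f : ℂ)‖ ^ 2 ≤ C * ‖f‖ ^ 2) :
    ∃ T : H →L[ℂ] lp (fun _ : κ => ℂ) 2, ∀ f n, T f n = inner ℂ (u n) f := by
  have hmem : ∀ f, Memℓp (fun n => (inner ℂ (u n) f : ℂ)) 2 := fun f =>
    memℓp_gen' (C := C * ‖f‖ ^ 2) (fun s => by simpa using hC f s)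
  let T₀ : H →ₗ[ℂ] lp (fun _ : κ => ℂ) 2 :=
    { toFun := fun f => ⟨fun n => inner ℂ (u n) f, hmem f⟩
      map_add' := fun f h => by ext n; exact inner_add_right _ _ _
      map_smul' := fun c f => by ext n; exact inner_smul_right _ _ _ }
  refine ⟨T₀.mkContinuous (Real.sqrt C) fun f => ?_, fun f n => rfl⟩
  refine lp.norm_le_of_forall_sum_le (by norm_num) (by positivity) fun s => ?_
  have := hC f s
  simp only [ENNReal.toReal_ofNat, Real.rpow_ofNat, mul_pow, Real.sq_sqrt hC0]
  exact this

end Bessel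

/-! ### Sampling on a lattice and periodization. -/

section Lattice

variable {ι : Type*} (A : (ι → ℝ) ≃L[ℝ] PhaseSpace d)

/-- The lattice points `A ℤ^ι`. -/
noncomputable def latticePoint (n : ι → ℤ) : PhaseSpace d := A fun i => (n i : ℝ)

lemma latticePoint_sub (n m : ι → ℤ) :
    latticePoint A (n - m) = latticePoint A n - latticePoint A m := by
  rw [latticePoint, latticePoint, latticePoint, ← map_sub]
  congr 1; ext i; simp

lemma latticePoint_injective : Function.Injective (latticePoint A) := by
  intro n m h
  have := A.injective h
  ext i
  exact_mod_cast congrFun this i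

lemma latticePoint_neg (n : ι → ℤ) :
    latticePoint A (-n) = -latticePoint A n := by
  rw [latticePoint, latticePoint, ← map_neg]
  congr 1; ext i; simp

lemma exists_separated [Fintype ι] : ∃ r : ℝ, 0 < r ∧ Pairwise fun n m : ι → ℤ =>
    Disjoint (Metric.ball (latticePoint A n) r) (Metric.ball (latticePoint A m) r) := by
  set K := ‖(A.symm : PhaseSpace d →L[ℝ] (ι → ℝ))‖ with hK
  have hK0 : 0 ≤ K := norm_nonneg _
  -- Distinct integer vectors have sup-distance at least 1, so lattice points are at least `1 / (K +
  -- 1)` apart; the `+ 1` avoids division by zero.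
  refine ⟨1 / (2 * (K + 1)), by positivity, fun n m hnm => Metric.ball_disjoint_ball ?_⟩
  obtain ⟨i, hi⟩ := Function.ne_iff.1 hnm
  have h1 : (1 : ℝ) ≤ ‖(fun i => ((n - m) i : ℝ))‖ := by
    refine le_trans ?_ (norm_le_pi_norm _ i)
    rw [Real.norm_eq_abs]
    exact_mod_cast Int.one_le_abs (sub_ne_zero.2 hi)
  have h2 : ‖(fun i => ((n - m) i : ℝ))‖ ≤ K * ‖latticePoint A (n - m)‖ := by
    have := (A.symm : PhaseSpace d →L[ℝ] (ι → ℝ)).le_opNorm (latticePoint A (n - m))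
    rwa [latticePoint, ContinuousLinearEquiv.coe_coe,
      ContinuousLinearEquiv.symm_apply_apply] at this
  rw [dist_eq_norm, ← latticePoint_sub, ← two_mul]
  have h3 : (1 : ℝ) ≤ (K + 1) * ‖latticePoint A (n - m)‖ := by
    nlinarith [norm_nonneg (latticePoint A (n - m))]
  rw [show 2 * (1 / (2 * (K + 1))) = 1 / (K + 1) by field_simp, div_le_iff₀ (by positivity)]
  linarith

lemma summable_norm_coeff_latticePoint [Fintype ι] {g g' : L2 d} (hg : ∫⁻ z, ‖coeff g g z‖ₑ < ⊤)
    (hg' : ∫⁻ z, ‖coeff g' g' z‖ₑ < ⊤) :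
    Summable fun n : ι → ℤ => ‖coeff g g' (latticePoint A n)‖ := by
  obtain ⟨r, hr, hp⟩ := exists_separated A
  have := ENNReal.summable_toReal (tsum_coeff_ne_top hr hp hg hg')
  simpa using this

lemma exists_analysis_coeff [Fintype ι] {g : L2 d} (hg : ∫⁻ z, ‖coeff g g z‖ₑ < ⊤) :
    ∃ T : L2 d →L[ℂ] lp (fun _ : ι → ℤ => ℂ) 2, ∀ f n, T f n = coeff g f (latticePoint A n) := by
  have hs := summable_norm_coeff_latticePoint A hg hg
  have hC0 : 0 ≤ ∑' n : ι → ℤ, ‖coeff g g (latticePoint A n)‖ :=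
    tsum_nonneg fun n => norm_nonneg _
  refine exists_analysis_operator (fun n => rep (latticePoint A n) g) hC0
    (sum_sq_norm_inner_le _ hC0 fun s n => ?_)
  simp only [norm_inner_rep_rep, ← latticePoint_sub]
  have h2 : Summable fun m : ι → ℤ => ‖coeff g g (latticePoint A (m - n))‖ :=
    (Equiv.subRight n).summable_iff.2 hs
  rw [← (Equiv.subRight n).tsum_eq fun m => ‖coeff g g (latticePoint A m)‖]
  exact h2.sum_le_tsum s fun m _ => norm_nonneg _

/-- Translating the argument by `z` costs the same phase in both factors, and the conjugation
cancels it. Sampling on a coset thus becomes sampling on the lattice with shifted `f` and `h`. -/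
lemma coeff_mul_conj_coeff_add (g f g' h : L2 d) (z l : PhaseSpace d) :
    coeff g f (z + l) * conj (coeff g' h (z + l)) =
      coeff g (rep (-z) f) l * conj (coeff g' (rep (-z) h) l) := by
  have key : ∀ g f : L2 d, coeff g f (z + l)
      = conj (wave (-(z + l).2) (-z).1) * coeff g (rep (-z) f) l := by
    intro g f
    rw [coeff, ← inner_rep_rep (-z), rep_rep, inner_smul_left, neg_add_cancel_left, coeff]
  have h1 : wave (-(z + l).2) (-z).1 * conj (wave (-(z + l).2) (-z).1) = 1 := by
    rw [conj_wave, wave_mul_neg]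
  rw [key g f, key g' h]
  simp only [map_mul, Complex.conj_conj]
  linear_combination (coeff g (rep (-z) f) l * conj (coeff g' (rep (-z) h) l)) * h1

/-- The periodization of the product of two short-time Fourier transforms converges absolutely to a
continuous function. -/
theorem exists_periodization [Fintype ι] {g g' : L2 d} (hg : ∫⁻ z, ‖coeff g g z‖ₑ < ⊤)
    (hg' : ∫⁻ z, ‖coeff g' g' z‖ₑ < ⊤) (f h : L2 d) :
    ∃ Φ : PhaseSpace d → ℂ, Continuous Φ ∧ ∀ z, HasSum (fun n : ι → ℤ =>
      coeff g f (z + latticePoint A n) * conj (coeff g' h (z + latticePoint A n))) (Φ z) := by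
  obtain ⟨T, hT⟩ := exists_analysis_coeff A hg
  obtain ⟨T', hT'⟩ := exists_analysis_coeff A hg'
  refine ⟨fun z => inner ℂ (T' (rep (-z) h)) (T (rep (-z) f)), ?_, fun z => ?_⟩
  · exact (T'.continuous.comp ((continuous_rep h).comp continuous_neg)).inner
      (T.continuous.comp ((continuous_rep f).comp continuous_neg))
  · have := lp.hasSum_inner (𝕜 := ℂ) (T' (rep (-z) h)) (T (rep (-z) f))
    simp only [hT, hT', RCLike.inner_apply] at this
    simpa only [coeff_mul_conj_coeff_add] using this

end Lattice

/-! ### Poisson summation on a lattice. -/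

section Poisson

variable {E : Type*} [NormedAddCommGroup E] [NormedSpace ℝ E] [FiniteDimensional ℝ E]
  {L : Submodule ℤ E} [DiscreteTopology L] [IsZLattice ℝ L] {ι : Type*} [Fintype ι]

/-- The coordinates adapted to a basis of a lattice. -/
noncomputable def latticeCoord (b : Module.Basis ι ℤ L) : (ι → ℝ) ≃L[ℝ] E :=
  (b.ofZLatticeBasis ℝ L).equivFunL.symm

lemma latticeCoord_symm_apply (b : Module.Basis ι ℤ L) (z : E) (i : ι) :
    (latticeCoord b).symm z i = (b.ofZLatticeBasis ℝ L).repr z i := rfl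

lemma latticeCoord_intCast (b : Module.Basis ι ℤ L) (n : ι → ℤ) :
    latticeCoord b (fun i => (n i : ℝ)) = (b.equivFun.symm n : L) := by
  have h1 : latticeCoord b (fun i => (n i : ℝ)) = ∑ i, (n i : ℝ) • b.ofZLatticeBasis ℝ L i :=
    (b.ofZLatticeBasis ℝ L).equivFun_symm_apply _
  rw [h1, Module.Basis.equivFun_symm_apply]
  push_cast
  refine Finset.sum_congr rfl fun i _ => ?_
  rw [b.ofZLatticeBasis_apply ℝ L, Int.cast_smul_eq_zsmul]

lemma latticeCoord_symm_coe (b : Module.Basis ι ℤ L) (l : L) (i : ι) :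
    (latticeCoord b).symm (l : E) i = (b.repr l i : ℝ) := by
  rw [latticeCoord_symm_apply, b.ofZLatticeBasis_repr_apply ℝ L]

/-- The character of a torus, in adapted coordinates. -/
noncomputable def latticeChar (b : Module.Basis ι ℤ L) (n : ι → ℤ) (z : E) : ℂ :=
  Complex.exp (-(2 * Real.pi * Complex.I * (∑ i, n i * (latticeCoord b).symm z i : ℝ)))

lemma norm_latticeChar (b : Module.Basis ι ℤ L) (n : ι → ℤ) (z : E) :
    ‖latticeChar b n z‖ = 1 := by
  have : (-(2 * Real.pi * Complex.I * (∑ i, n i * (latticeCoord b).symm z i : ℝ)) : ℂ)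
      = ((-(2 * Real.pi * ∑ i, n i * (latticeCoord b).symm z i) : ℝ) : ℂ) * Complex.I := by
    push_cast; ring
  rw [latticeChar, this]
  exact Complex.norm_exp_ofReal_mul_I _

lemma continuous_latticeChar (b : Module.Basis ι ℤ L) (n : ι → ℤ) :
    Continuous (latticeChar b n) := by
  unfold latticeChar
  have : ∀ i, Continuous fun z : E => (latticeCoord b).symm z i := fun i =>
    (continuous_apply i).comp (latticeCoord b).symm.continuous
  fun_prop

lemma latticeChar_add_coe (b : Module.Basis ι ℤ L) (n : ι → ℤ) (l : L) (z : E) :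
    latticeChar b n (l + z) = latticeChar b n z := by
  unfold latticeChar
  rw [map_add]
  simp only [Pi.add_apply, latticeCoord_symm_coe, mul_add, Finset.sum_add_distrib]
  rw [Complex.exp_eq_exp_iff_exists_int]
  refine ⟨-∑ i, n i * b.repr l i, ?_⟩
  push_cast; ring

lemma mFourier_neg_latticeCoord (b : Module.Basis ι ℤ L) (n : ι → ℤ) (v : ι → ℝ) :
    UnitAddTorus.mFourier (-n) (fun i => (v i : UnitAddCircle))
      = latticeChar b n (latticeCoord b v) := by
  simp only [UnitAddTorus.mFourier, ContinuousMap.coe_mk, latticeChar,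
    ContinuousLinearEquiv.symm_apply_apply, fourier_coe_apply]
  rw [← Complex.exp_sum]
  congr 1
  push_cast
  rw [Finset.mul_sum, ← Finset.sum_neg_distrib]
  refine Finset.sum_congr rfl fun i _ => ?_
  push_cast [Pi.neg_apply]; ring

variable [MeasurableSpace E] [BorelSpace E]

/-- The integral over a fundamental domain, in adapted coordinates. -/
lemma setIntegral_fundamentalDomain_eq (b : Module.Basis ι ℤ L) (μ : Measure E)
    [μ.IsAddHaarMeasure] (G : E → ℂ) :
    ∫ z in ZSpan.fundamentalDomain (b.ofZLatticeBasis ℝ L), G z ∂μ =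
      ZLattice.covolume L μ * ∫ v in {v : ι → ℝ | ∀ i, v i ∈ Set.Ioc (0 : ℝ) (0 + 1)},
        G (latticeCoord b v) := by
  set A := latticeCoord b with hA
  set D := ZSpan.fundamentalDomain (b.ofZLatticeBasis ℝ L) with hD
  have hAm : MeasurableEmbedding A := A.toHomeomorph.measurableEmbedding
  have hν : (Measure.map A volume).IsAddHaarMeasure := A.isAddHaarMeasure_map volume
  have hpre : A ⁻¹' D = Set.univ.pi fun _ => Set.Ico (0 : ℝ) 1 := by
    ext v
    rw [Set.mem_preimage, hD, ZSpan.mem_fundamentalDomain]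
    simp only [Set.mem_univ_pi]
    refine forall_congr' fun i => ?_
    rw [← latticeCoord_symm_apply, ← hA, A.symm_apply_apply]
  -- The fundamental domain is the cube `[0,1)^ι`, torus integrals use `(0,1]^ι`; both agree with
  -- the closed cube up to null sets.
  have hae : (A ⁻¹' D : Set (ι → ℝ)) =ᵐ[volume] {v | ∀ i, v i ∈ Set.Ioc (0 : ℝ) (0 + 1)} := by
    have h1 := Measure.univ_pi_Ico_ae_eq_Icc (μ := fun _ : ι => (volume : Measure ℝ))
      (f := fun _ => 0) (g := fun _ => 1)
    have h2 := Measure.univ_pi_Ioc_ae_eq_Icc (μ := fun _ : ι => (volume : Measure ℝ))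
      (f := fun _ => 0) (g := fun _ => 1)
    have h3 : {v : ι → ℝ | ∀ i, v i ∈ Set.Ioc (0 : ℝ) (0 + 1)}
        = Set.univ.pi fun _ => Set.Ioc (0 : ℝ) 1 := by
      ext v; simp [Set.mem_pi]
    rw [hpre, h3, volume_pi]
    exact h1.trans h2.symm
  have hμ : μ = Measure.addHaarScalarFactor μ (Measure.map A volume) • Measure.map A volume :=
    Measure.isAddLeftInvariant_eq_smul _ _
  set c := Measure.addHaarScalarFactor μ (Measure.map A volume) with hc
  -- The preimage of the fundamental domain is a unit cube, so the Haar scalar factor is the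
  -- covolume.
  have hcov : ZLattice.covolume L μ = c := by
    rw [ZLattice.covolume_eq_measure_fundamentalDomain L μ (ZLattice.isAddFundamentalDomain b μ),
      ← hD, measureReal_def, hμ, Measure.smul_apply, hAm.map_apply, hpre, Real.volume_pi_Ico]
    simp [ENNReal.smul_def]
  rw [hcov]
  nth_rewrite 1 [hμ]
  rw [Measure.restrict_smul, integral_smul_nnreal_measure, hAm.setIntegral_map,
    setIntegral_congr_set hae]
  rfl

/-- Unfolding of the integral of a periodization. -/
lemma setIntegral_periodization (b : Module.Basis ι ℤ L) (μ : Measure E) [μ.IsAddHaarMeasure]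
    {F Φ : E → ℂ} (hF : Integrable F μ) (hΦ : ∀ z, HasSum (fun l : L => F (z + l)) (Φ z))
    (n : ι → ℤ) :
    ∫ z in ZSpan.fundamentalDomain (b.ofZLatticeBasis ℝ L), latticeChar b n z * Φ z ∂μ
      = ∫ z, latticeChar b n z * F z ∂μ := by
  have : MeasurableVAdd L E := (inferInstance : MeasurableVAdd L.toAddSubgroup E)
  have : VAddInvariantMeasure L E μ := (inferInstance : VAddInvariantMeasure L.toAddSubgroup E μ)
  have hdom := ZLattice.isAddFundamentalDomain b μ
  set G : E → ℂ := fun z => latticeChar b n z * F z with hG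
  have hGi : Integrable G μ := hF.bdd_mul (c := 1)
    (continuous_latticeChar b n).aestronglyMeasurable
    (Filter.Eventually.of_forall fun z => (norm_latticeChar b n z).le)
  have hsum : ∀ z, latticeChar b n z * Φ z = ∑' l : L, G (l +ᵥ z) := by
    intro z
    rw [← ((hΦ z).mul_left (latticeChar b n z)).tsum_eq]
    refine tsum_congr fun l => ?_
    simp only [hG, Submodule.vadd_def, vadd_eq_add, latticeChar_add_coe, add_comm z]
  rw [hdom.integral_eq_tsum'' G hGi]
  simp only [hsum]
  refine integral_tsum (fun l => ?_) ?_
  · have h1 : MeasurePreserving (fun z : E => l +ᵥ z) μ μ := measurePreserving_vadd l μ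
    exact (hGi.1.comp_measurePreserving h1).restrict
  · rw [← hdom.lintegral_eq_tsum'' fun z => ‖G z‖ₑ]
    exact hGi.2.ne

/-- Poisson summation for functions whose periodization is continuous with absolutely convergent
Fourier series. -/
theorem poisson_summation (b : Module.Basis ι ℤ L) (μ : Measure E) [μ.IsAddHaarMeasure]
    {F Φ : E → ℂ} (hF : Integrable F μ) (hΦc : Continuous Φ)
    (hΦ : ∀ z, HasSum (fun l : L => F (z + l)) (Φ z))
    (hs : Summable fun n : ι → ℤ => ∫ z, latticeChar b n z * F z ∂μ) :
    Φ 0 = ((ZLattice.covolume L μ : ℝ) : ℂ)⁻¹ *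
      ∑' n : ι → ℤ, ∫ z, latticeChar b n z * F z ∂μ := by
  have hper : ∀ (z : E) (l : L), Φ (z + l) = Φ z := by
    intro z l
    have h1 := hΦ (z + l)
    have h2 := (Equiv.addLeft l).hasSum_iff.2 (hΦ z)
    refine h1.unique (h2.congr_fun fun k => ?_)
    simp [add_assoc]
  set q : (ι → ℝ) → UnitAddTorus ι := fun v i => (v i : UnitAddCircle) with hq
  have hqq : IsOpenQuotientMap q :=
    IsOpenQuotientMap.piMap fun _ => QuotientAddGroup.isOpenQuotientMap_mk
  -- The representative in `[0,1)` jumps, but periodicity makes the composite with the open quotient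
  -- map `q` equal to `Φ` in coordinates, whence continuity.
  set Ψ₀ : UnitAddTorus ι → ℂ := fun x =>
    Φ (latticeCoord b fun i => (AddCircle.equivIco 1 0 (x i) : ℝ)) with hΨ₀
  have hΨq : ∀ v, Ψ₀ (q v) = Φ (latticeCoord b v) := by
    intro v
    have h1 : ∀ i, ∃ k : ℤ, (v i : ℝ) = (AddCircle.equivIco 1 0 (v i : UnitAddCircle) : ℝ) + k := by
      intro i
      have h2 : ((v i - (AddCircle.equivIco 1 0 (v i : UnitAddCircle) : ℝ) : ℝ) : UnitAddCircle)
          = 0 := by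
        rw [AddCircle.coe_sub, AddCircle.coe_equivIco, sub_self]
      obtain ⟨k, hk⟩ := (AddCircle.coe_eq_zero_iff 1).1 h2
      refine ⟨k, ?_⟩
      simp only [zsmul_eq_mul, mul_one] at hk
      linarith
    choose k hk using h1
    have h3 : v = (fun i => (AddCircle.equivIco 1 0 (v i : UnitAddCircle) : ℝ))
        + fun i => (k i : ℝ) := funext hk
    conv_rhs => rw [h3, map_add, latticeCoord_intCast, hper]
  have hΨc : Continuous Ψ₀ := by
    rw [hqq.isQuotientMap.continuous_iff]
    exact (hΦc.comp (latticeCoord b).continuous).congr fun v => (hΨq v).symm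
  set Ψ : C(UnitAddTorus ι, ℂ) := ⟨Ψ₀, hΨc⟩ with hΨ
  have hcov : ((ZLattice.covolume L μ : ℝ) : ℂ) ≠ 0 :=
    Complex.ofReal_ne_zero.2 (ZLattice.covolume_ne_zero L μ)
  have hcoef : ∀ n, UnitAddTorus.mFourierCoeff Ψ n
      = ((ZLattice.covolume L μ : ℝ) : ℂ)⁻¹ * ∫ z, latticeChar b n z * F z ∂μ := by
    intro n
    -- Base point 0 gives the cube used in `setIntegral_fundamentalDomain_eq`.
    rw [UnitAddTorus.mFourierCoeff_eq_integral Ψ n fun _ => 0, ← setIntegral_periodization b μ hF hΦ,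
      setIntegral_fundamentalDomain_eq, inv_mul_cancel_left₀ hcov]
    refine integral_congr_ae (Filter.Eventually.of_forall fun v => ?_)
    simp only [mFourier_neg_latticeCoord b, smul_eq_mul]
    congr 1
    exact hΨq v
  have hsum : Summable (UnitAddTorus.mFourierCoeff Ψ) := by
    simp only [funext hcoef]
    exact hs.mul_left _
  have h0 := (UnitAddTorus.hasSum_mFourier_series_apply_of_summable hsum (q 0)).tsum_eq
  have h1 : Ψ (q 0) = Φ 0 := by
    have := hΨq 0
    rwa [map_zero] at this
  rw [← h1, ← h0, ← tsum_mul_left]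
  refine tsum_congr fun n => ?_
  rw [hcoef]
  have : UnitAddTorus.mFourier n (q 0) = 1 := by
    simp [UnitAddTorus.mFourier, hq]
  rw [this, smul_eq_mul, mul_one]

end Poisson

/-! ### Symplectic duality and the adjoint lattice. -/

/-- The symplectic form of the time-frequency plane. -/
noncomputable def symplectic (w z : PhaseSpace d) : ℝ := inner ℝ w.2 z.1 - inner ℝ w.1 z.2

lemma symplectic_add_left (w w' z : PhaseSpace d) :
    symplectic (w + w') z = symplectic w z + symplectic w' z := by
  simp only [symplectic, Prod.fst_add, Prod.snd_add, inner_add_left]; ring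

lemma symplectic_smul_left (c : ℝ) (w z : PhaseSpace d) :
    symplectic (c • w) z = c * symplectic w z := by
  simp only [symplectic, Prod.smul_fst, Prod.smul_snd, real_inner_smul_left]; ring

/-- The symplectic form as a linear functional of its second argument. -/
noncomputable def symplecticRight (w : PhaseSpace d) : PhaseSpace d →ₗ[ℝ] ℝ where
  toFun := symplectic w
  map_add' z z' := by
    simp only [symplectic, Prod.fst_add, Prod.snd_add, inner_add_right]; ring
  map_smul' c z := by
    simp only [symplectic, Prod.smul_fst, Prod.smul_snd, real_inner_smul_right, smul_eq_mul,
      RingHom.id_apply]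
    ring

/-- The factor by which two time-frequency shifts fail to commute. -/
noncomputable def commutator (z w : PhaseSpace d) : ℂ := wave (-w.2) z.1 * wave z.2 w.1

lemma commutator_eq (z w : PhaseSpace d) :
    commutator z w = Complex.exp (-(2 * Real.pi * Complex.I * (symplectic w z : ℝ))) := by
  rw [commutator, wave, wave, ← Complex.exp_add, symplectic, inner_neg_left,
    real_inner_comm w.1 z.2]
  congr 1; push_cast; ring

lemma coeff_rep_rep (w : PhaseSpace d) (g h : L2 d) (z : PhaseSpace d) :
    coeff (rep w g) (rep w h) z = conj (commutator z w) * coeff g h z := by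
  rw [coeff, rep_comm, inner_smul_left, inner_rep_rep, coeff, commutator]

/-- The Fourier coefficients of products of short-time Fourier transforms. -/
theorem integral_commutator_mul (g f g' h : L2 d) (w : PhaseSpace d) :
    ∫ z, commutator z w * (coeff g f z * conj (coeff g' h z)) =
      coeff h f w * conj (coeff g' g w) := by
  have h1 := integral_coeff_mul g f (rep w g') (rep w h)
  rw [coeff, coeff, inner_conj_symm, ← h1]
  refine integral_congr_ae (Filter.Eventually.of_forall fun z => ?_)
  simp only [coeff_rep_rep, map_mul, Complex.conj_conj]
  ring

/-- Inner products are conjugate-symmetric, so reflecting the point exchanges the roles of window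
and function; the phases cancel between the two factors. -/
lemma coeff_mul_conj_coeff_neg (g g' f h : L2 d) (w : PhaseSpace d) :
    coeff h f w * conj (coeff g' g w) = coeff g g' (-w) * conj (coeff f h (-w)) := by
  have := coeff_mul_conj_coeff_add g g' f h (-w) 0
  rw [add_zero, neg_neg] at this
  rw [this]
  simp only [coeff, rep_zero, inner_conj_symm]
  ring

/-- A point belongs to the adjoint lattice iff all commutators with lattice points are trivial. -/
lemma mem_adjointLattice_iff (Λ : Submodule ℤ (PhaseSpace d)) (w : PhaseSpace d) :
    w ∈ adjointLattice Λ ↔ ∀ l ∈ Λ, commutator l w = 1 := by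
  constructor
  · intro hw l hl
    obtain ⟨φ, hφ, -⟩ := exists_gaussian_window (d := d)
    have h1 : rep l (rep w φ) = rep w (rep l φ) := by
      apply Lp.ext
      filter_upwards [hw l hl φ (Lp.memLp φ), coeFn_rep l (rep w φ), coeFn_rep w (rep l φ),
        tfShift_congr (coeFn_rep w φ) l, tfShift_congr (coeFn_rep l φ) w] with t a1 a2 a3 a4 a5
      rw [a2, a3, a4, a5, a1]
    have h2 : rep w (rep l φ) ≠ 0 := by
      rw [← norm_ne_zero_iff, norm_rep, norm_rep]
      exact norm_ne_zero_iff.2 hφ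
    rw [rep_comm] at h1
    have h3 : (commutator l w - 1) • rep w (rep l φ) = 0 := by
      rw [sub_smul, one_smul, sub_eq_zero]; exact h1
    exact sub_eq_zero.1 ((smul_eq_zero.1 h3).resolve_right h2)
  · intro hw l hl f _
    refine Filter.Eventually.of_forall fun t => ?_
    have h1 := hw l hl
    rw [commutator] at h1
    rw [tfShift_tfShift, tfShift_tfShift, add_comm w l]
    have h2 := wave_mul_neg l.2 w.1
    linear_combination (tfShift (l + w) f t) * wave (-l.2) w.1 * h1 -
      wave (-w.2) l.1 * tfShift (l + w) f t * h2

section Dual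

variable {ι : Type*} [Fintype ι] (A : (ι → ℝ) ≃L[ℝ] PhaseSpace d)

/-- The symplectic form with a fixed second argument, in coordinates. -/
lemma symplectic_eq_sum [DecidableEq ι] (w z : PhaseSpace d) :
    symplectic w z = ∑ i, symplectic w (A (Pi.single i 1)) * A.symm z i := by
  have h1 : z = ∑ i, A.symm z i • A (Pi.single i 1) := by
    conv_lhs => rw [← A.apply_symm_apply z, pi_eq_sum_univ' (A.symm z), map_sum]
    refine Finset.sum_congr rfl fun i _ => ?_
    rw [map_smul]
  have h2 : symplectic w z = symplecticRight w z := rfl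
  rw [h2]
  conv_lhs => rw [h1, map_sum]
  refine Finset.sum_congr rfl fun i _ => ?_
  rw [map_smul, smul_eq_mul, mul_comm]
  rfl

/-- Symplectically dual coordinates. -/
theorem exists_dual_coordinates : ∃ A' : (ι → ℝ) ≃L[ℝ] PhaseSpace d,
    ∀ v z, symplectic (A' v) z = ∑ i, v i * A.symm z i := by
  classical
  let D : PhaseSpace d →ₗ[ℝ] (ι → ℝ) :=
    { toFun := fun w i => symplectic w (A (Pi.single i 1))
      map_add' := fun w w' => by ext i; exact symplectic_add_left _ _ _
      map_smul' := fun c w => by ext i; exact symplectic_smul_left _ _ _ }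
  have hD : ∀ w i, D w i = symplectic w (A (Pi.single i 1)) := fun _ _ => rfl
  have hinj : Function.Injective D := by
    rw [← LinearMap.ker_eq_bot, LinearMap.ker_eq_bot']
    intro w hw
    -- Nondegeneracy: this pairing equals `‖w.2‖² + ‖w.1‖²`.
    have h1 : symplectic w (w.2, -w.1) = 0 := by
      rw [symplectic_eq_sum A]
      refine Finset.sum_eq_zero fun i _ => ?_
      rw [← hD, hw, Pi.zero_apply, zero_mul]
    simp only [symplectic, inner_neg_right, real_inner_self_eq_norm_sq] at h1
    have h2 : ‖w.1‖ = 0 := by nlinarith [sq_nonneg ‖w.1‖, sq_nonneg ‖w.2‖]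
    have h3 : ‖w.2‖ = 0 := by nlinarith [sq_nonneg ‖w.1‖, sq_nonneg ‖w.2‖]
    exact Prod.ext (norm_eq_zero.1 h2) (norm_eq_zero.1 h3)
  let e := LinearEquiv.ofInjectiveOfFinrankEq D hinj A.toLinearEquiv.finrank_eq.symm
  refine ⟨e.symm.toContinuousLinearEquiv, fun v z => ?_⟩
  rw [symplectic_eq_sum A]
  refine Finset.sum_congr rfl fun i _ => ?_
  rw [← hD]
  congr 1
  exact congrFun (e.apply_symm_apply v) i

end Dual

/-! ### The fundamental identity. -/

section Main

variable {Λ : Submodule ℤ (PhaseSpace d)} [DiscreteTopology Λ] [IsZLattice ℝ Λ]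
  {ι : Type*} [Fintype ι]

lemma commutator_latticePoint (b : Module.Basis ι ℤ Λ) {A' : (ι → ℝ) ≃L[ℝ] PhaseSpace d}
    (hA' : ∀ v z, symplectic (A' v) z = ∑ i, v i * (latticeCoord b).symm z i) (n : ι → ℤ)
    (z : PhaseSpace d) : commutator z (latticePoint A' n) = latticeChar b n z := by
  rw [commutator_eq, latticePoint, hA', latticeChar]

/-- The adjoint lattice consists of the lattice points of the dual coordinates. -/
lemma mem_adjointLattice_iff_exists (b : Module.Basis ι ℤ Λ)
    {A' : (ι → ℝ) ≃L[ℝ] PhaseSpace d}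
    (hA' : ∀ v z, symplectic (A' v) z = ∑ i, v i * (latticeCoord b).symm z i)
    (w : PhaseSpace d) : w ∈ adjointLattice Λ ↔ ∃ n : ι → ℤ, latticePoint A' n = w := by
  rw [mem_adjointLattice_iff]
  constructor
  · intro hw
    have h1 : ∀ i, ∃ k : ℤ, A'.symm w i = k := by
      intro i
      have h2 := hw (b i) (b i).2
      -- Dual coordinates are the symplectic pairings with the basis vectors, and a trivial
      -- commutator forces each to be an integer.
      have h3 : symplectic w (b i : PhaseSpace d) = A'.symm w i := by
        classical
        conv_lhs => rw [← A'.apply_symm_apply w, hA']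
        simp only [latticeCoord_symm_coe, Module.Basis.repr_self]
        simp [Finsupp.single_apply]
      rw [commutator_eq, h3, Complex.exp_eq_one_iff] at h2
      obtain ⟨k, hk⟩ := h2
      refine ⟨-k, ?_⟩
      have h4 : ((A'.symm w i : ℝ) : ℂ) = ((-k : ℤ) : ℂ) := by
        have h5 : (2 * Real.pi * Complex.I : ℂ) ≠ 0 := Complex.two_pi_I_ne_zero
        apply mul_left_cancel₀ h5
        push_cast
        linear_combination -hk
      exact_mod_cast h4
    choose n hn using h1
    refine ⟨n, ?_⟩
    rw [latticePoint, ← A'.apply_symm_apply w]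
    congr 1
    exact funext fun i => (hn i).symm
  · rintro ⟨n, rfl⟩ l hl
    rw [commutator_latticePoint b hA']
    have := latticeChar_add_coe b n ⟨l, hl⟩ 0
    rw [add_zero] at this
    rw [this]
    simp [latticeChar]

lemma latticePoint_latticeCoord (b : Module.Basis ι ℤ Λ) (l : Λ) :
    latticePoint (latticeCoord b) (b.equivFun l) = l := by
  rw [latticePoint, latticeCoord_intCast, LinearEquiv.symm_apply_apply]

/-- The fundamental identity for the matrix coefficients of the time-frequency shifts. -/
theorem fundamental_identity {g g' : L2 d} (hg : ∫⁻ z, ‖coeff g g z‖ₑ < ⊤)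
    (hg' : ∫⁻ z, ‖coeff g' g' z‖ₑ < ⊤) (f h : L2 d) :
    Summable (fun l : Λ => coeff g f l * conj (coeff g' h l)) ∧
    Summable (fun m : adjointLattice Λ => coeff g g' m * conj (coeff f h m)) ∧
    ∑' l : Λ, coeff g f l * conj (coeff g' h l) =
      ((ZLattice.covolume Λ : ℝ) : ℂ)⁻¹ *
        ∑' m : adjointLattice Λ, coeff g g' m * conj (coeff f h m) := by
  have : Module.Finite ℤ Λ := ZLattice.module_finite ℝ Λ
  have : Module.Free ℤ Λ := ZLattice.module_free ℝ Λ
  let b := Module.Free.chooseBasis ℤ Λ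
  obtain ⟨A', hA'⟩ := exists_dual_coordinates (latticeCoord b)
  obtain ⟨Φ, hΦc, hΦ⟩ := exists_periodization (latticeCoord b) hg hg' f h
  have hΦ' : ∀ z : PhaseSpace d, HasSum (fun l : Λ =>
      coeff g f (z + l) * conj (coeff g' h (z + l))) (Φ z) := by
    intro z
    have := b.equivFun.toEquiv.hasSum_iff.2 (hΦ z)
    refine this.congr_fun fun l => ?_
    simp only [Function.comp, LinearEquiv.coe_toEquiv, latticePoint_latticeCoord]
  have hcoef : ∀ n, ∫ z, latticeChar b n z * (coeff g f z * conj (coeff g' h z)) =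
      coeff h f (latticePoint A' n) * conj (coeff g' g (latticePoint A' n)) := by
    intro n
    simp only [← commutator_latticePoint b hA', integral_commutator_mul]
  have hs : Summable fun n =>
      coeff h f (latticePoint A' n) * conj (coeff g' g (latticePoint A' n)) := by
    -- The factor involving the arbitrary `f` and `h` is only bounded; summability comes from the
    -- two windows.
    refine Summable.of_norm_bounded
      ((summable_norm_coeff_latticePoint A' hg' hg).mul_left (‖h‖ * ‖f‖)) fun n => ?_
    rw [norm_mul, RCLike.norm_conj]
    exact mul_le_mul_of_nonneg_right (norm_coeff_le _ _ _) (norm_nonneg _)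
  have hpoisson := poisson_summation b volume (integrable_coeff_mul g f g' h) hΦc hΦ'
    (by simpa only [hcoef] using hs)
  simp only [hcoef] at hpoisson
  -- The sign is the reflection from `coeff_mul_conj_coeff_neg`.
  let e : (Module.Free.ChooseBasisIndex ℤ Λ → ℤ) ≃ adjointLattice Λ :=
    Equiv.ofBijective (fun n => ⟨latticePoint A' (-n),
      (mem_adjointLattice_iff_exists b hA' _).2 ⟨-n, rfl⟩⟩) ⟨fun n m hnm =>
        neg_injective (latticePoint_injective A' (Subtype.ext_iff.1 hnm)), fun w => by
          obtain ⟨n, hn⟩ := (mem_adjointLattice_iff_exists b hA' _).1 w.2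
          exact ⟨-n, Subtype.ext (by simpa using hn)⟩⟩
  have he : ∀ n, coeff h f (latticePoint A' n) * conj (coeff g' g (latticePoint A' n)) =
      coeff g g' (e n) * conj (coeff f h (e n)) := by
    intro n
    rw [coeff_mul_conj_coeff_neg, ← latticePoint_neg]
    rfl
  have h0 := hΦ' 0
  simp only [zero_add] at h0
  refine ⟨h0.summable, ?_, ?_⟩
  · rw [← e.summable_iff]
    exact hs.congr he
  · rw [h0.tsum_eq, hpoisson, ← e.tsum_eq fun m : adjointLattice Λ =>
      coeff g g' m * conj (coeff f h m)]
    simp only [he]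

end Main

lemma lintegral_coeff_lt_top_of_mem_M1 {g : Space d → ℂ} (hg : g ∈ M1 d) :
    ∫⁻ z, ‖coeff (hg.1.toLp g) (hg.1.toLp g) z‖ₑ < ⊤ := by
  have := hg.2.2
  rw [hasFiniteIntegral_iff_enorm] at this
  simpa only [stft_eq_coeff hg.1 hg.1] using this

end Gabor

/-- Fundamental identity of Gabor analysis, with absolute convergence of both sums. -/
theorem mainTheorem9 (d : ℕ) (f h g g' : Gabor.Space d → ℂ)
    (hf : MemLp f 2 volume) (hh : MemLp h 2 volume)
    (hg : g ∈ Gabor.M1 d) (hg' : g' ∈ Gabor.M1 d)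
    (Λ : Submodule ℤ (Gabor.PhaseSpace d)) [DiscreteTopology Λ] [IsZLattice ℝ Λ] :
    Summable (fun l : Λ => ‖Gabor.stft g f l * conj (Gabor.stft g' h l)‖) ∧
    Summable (fun m : Gabor.adjointLattice Λ =>
      ‖Gabor.stft g g' m * conj (Gabor.stft f h m)‖) ∧
    ∑' l : Λ, Gabor.stft g f l * conj (Gabor.stft g' h l) =
      ((ZLattice.covolume Λ : ℝ) : ℂ)⁻¹ *
        ∑' m : Gabor.adjointLattice Λ, Gabor.stft g g' m * conj (Gabor.stft f h m) := by
  simp only [Gabor.stft_eq_coeff hg.1 hf, Gabor.stft_eq_coeff hg'.1 hh,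
    Gabor.stft_eq_coeff hg.1 hg'.1, Gabor.stft_eq_coeff hf hh]
  obtain ⟨h1, h2, h3⟩ := Gabor.fundamental_identity (Λ := Λ)
    (Gabor.lintegral_coeff_lt_top_of_mem_M1 hg) (Gabor.lintegral_coeff_lt_top_of_mem_M1 hg')
    (hf.toLp f) (hh.toLp h)
  exact ⟨h1.norm, h2.norm, h3⟩
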